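/- Theorem 4.2. Let $X$ and $Y$ be Polish spaces with Borel probability measures $\mu$ and $\nu$, and let $c:X\times Y\to[0,\infty]$ be Borel measurable. Let $\Pi(\mu,\nu)$ be the set of Borel measures on $X\times Y$ with marginals $\mu,\nu$, write $\langle c,\pi\rangle=\int c\,d\pi$, let $\Pi(\mu,\nu,c)=\{\pi\in\Pi(\mu,\nu):\langle c,\pi\rangle<\infty\}$, assumed non-empty, and $P=\inf\{\langle c,\pi\rangle:\pi\in\Pi(\mu,\nu)\}$. Write $\pi_1\preceq\pi_2$ if $\pi_1\ll\pi_2$ and $\big\|\frac{d\pi_1}{d\pi_2}\big\|_{L^\infty(\pi_2)}<\infty$. For $\pi\in\Pi(\mu,\nu,c)$ put $$P^{(\pi)}=\inf\{\langle c,\pi'\rangle:\pi'\in\Pi(\mu,\nu),\ \pi'\preceq\pi\},$$ $$D^{(\pi)}=\lim_{\varepsilon\downarrow0}\sup\Big\{\int\phi\,d\mu+\int\psi\,d\nu:\ \phi\in L^1(\mu),\ \psi\in L^1(\nu),\ \int(\phi\oplus\psi-c)_+\,d\pi\le\varepsilon\Big\},$$ where $(\phi\oplus\psi)(x,y)=\phi(x)+\psi(y)$.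 Let $L^1_S(\pi)$ be the closed linear span in $L^1(\pi)$ of all $\phi\oplus\psi$ with $\phi\in L^1(\mu)$, $\psi\in L^1(\nu)$; regard $L^1_S(\pi)^{**}$ as a subspace of $L^1(\pi)^{**}=L^\infty(\pi)^*$ (a space of finitely additive measures, with its Banach lattice order), identify $c$ with an element of $L^1(\pi)\subseteq L^1(\pi)^{**}$ and $\pi$ with the constant $1\in L^\infty(\pi)$, and put $$D^{(\pi)}_{**}=\sup\{\langle h,\pi\rangle:\ h\in L^1_S(\pi)^{**},\ h\le c\text{ in }L^1(\pi)^{**}\}.$$ For $\pi_1\preceq\pi_2$ let $P_{\pi_1,\pi_2}:L^1(\pi_2)\to L^1(\pi_1)$ be the natural projection (the class of $f$ modulo $\pi_2$-null functions goes to its class modulo $\pi_1$-null functions). Let $\pi_0\in\Pi(\mu,\nu,c)$ satisfy $P^{(\pi_0)}=\inf_{\pi\in\Pi(\mu,\nu,c)}P^{(\pi)}$. Then there is a family $\hat H=(\hat h_\pi)$, indexed by the $\pi\in\Pi(\mu,\nu,c)$ with $\pi\succeq\pi_0$, which belongs to the projective limit of the spaces $L^1(\pi)^{**}$, that is, $\hat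 h_\pi\in L^1(\pi)^{**}$ and $P_{\pi_1,\pi_2}^{**}(\hat h_{\pi_2})=\hat h_{\pi_1}$ whenever $\pi_0\preceq\pi_1\preceq\pi_2$, such that for each such $\pi$: - $\hat h_\pi\in L^1_S(\pi)^{**}$, $\hat h_\pi\le c$ in $L^1(\pi)^{**}$, and $\langle\hat h_\pi,\pi\rangle=D^{(\pi)}_{**}$; - in the unique decomposition $\hat h_\pi=\hat h^r_\pi+\hat h^s_\pi$ into a regular part $\hat h^r_\pi\in L^1(\pi)$ and a purely singular (purely finitely additive) part $\hat h^s_\pi\in L^1(\pi)^{**}$ one has $\hat h^r_\pi\le c$ in $L^1(\pi)$ and $\hat h^s_\pi\le0$. Moreover, for each $\pi\in\Pi(\mu,\nu,c)$ with $\pi\succeq\pi_0$ the limit defining $D^{(\pi)}$ exists and $$D^{(\pi)}_{**}=D^{(\pi)}=P^{(\pi)}=P^{(\pi_0)}.$$ If in addition $P$ is attained by some $\pi\in\Pi(\mu,\nu)$, which is the case for instance if $c$ is lower semicontinuous, then $D^{(\pi)}_{**}=D^{(\pi)}=P^{(\pi)}=P$ for each such $\pi$. -/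

import Mathlib

open MeasureTheory Filter Topology
open scoped ENNReal

namespace TransportBidual

noncomputable section

/-! ### Transport plans and primal values -/

section Plans

variable {X Y : Type*} [MeasurableSpace X] [MeasurableSpace Y]

/-- `Π(μ, ν)`: the measures on `X × Y` with marginals `μ` and `ν`. -/
def plans (μ : Measure X) (ν : Measure Y) : Set (Measure (X × Y)) :=
  {π | π.fst = μ ∧ π.snd = ν}

/-- `Π(μ, ν, c)`: the transport plans of finite cost. -/
def finitePlans (μ : Measure X) (ν : Measure Y) (c : X × Y → ℝ≥0∞) : Set (Measure (X × Y)) :=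
  {π | π ∈ plans μ ν ∧ ∫⁻ z, c z ∂π ≠ ∞}

/-- `π₁ ⪯ π₂`: absolute continuity with an essentially bounded density. -/
def PlanLE {Z : Type*} [MeasurableSpace Z] (π₁ π₂ : Measure Z) : Prop :=
  π₁ ≪ π₂ ∧ essSup (π₁.rnDeriv π₂) π₂ < ∞

/-- The primal value `P`. -/
def primal (μ : Measure X) (ν : Measure Y) (c : X × Y → ℝ≥0∞) : ℝ≥0∞ :=
  ⨅ π ∈ plans μ ν, ∫⁻ z, c z ∂π

/-- The primal problem has an optimizer. -/
def PrimalAttained (μ : Measure X) (ν : Measure Y) (c : X × Y → ℝ≥0∞) : Prop :=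
  ∃ π ∈ plans μ ν, ∫⁻ z, c z ∂π = primal μ ν c

/-- `P^(π)`: the infimum of the cost over the plans with bounded density with respect to `π`. -/
def primalAt (μ : Measure X) (ν : Measure Y) (c : X × Y → ℝ≥0∞) (π : Measure (X × Y)) : ℝ≥0∞ :=
  ⨅ π' ∈ {π' | π' ∈ plans μ ν ∧ PlanLE π' π}, ∫⁻ z, c z ∂π'

/-- `D^(π, ε)`. The integrand of the constraint is `(φ ⊕ ψ - c)₊`: as `c ≥ 0`, it equals
`(φ ⊕ ψ)₊ - c` with the truncated subtraction of `ℝ≥0∞`. -/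
def dualEps (μ : Measure X) (ν : Measure Y) (c : X × Y → ℝ≥0∞) (π : Measure (X × Y)) (ε : ℝ) :
    EReal :=
  ⨆ p ∈ {p : (X → ℝ) × (Y → ℝ) | Integrable p.1 μ ∧ Integrable p.2 ν ∧
      ∫⁻ z, (ENNReal.ofReal (p.1 z.1 + p.2 z.2) - c z) ∂π ≤ ENNReal.ofReal ε},
    ((∫ x, p.1 x ∂μ + ∫ y, p.2 y ∂ν : ℝ) : EReal)

/-- `D^(π)`, the limit of `D^(π, ε)` as `ε` decreases to `0`. -/
def dualAt (μ : Measure X) (ν : Measure Y) (c : X × Y → ℝ≥0∞) (π : Measure (X × Y)) : EReal :=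
  limUnder (𝓝[>] (0 : ℝ)) (dualEps μ ν c π)

end Plans

/-! ### Biduals -/

/-- The bidual of a normed space. -/
abbrev Bidual (E : Type*) [NormedAddCommGroup E] [NormedSpace ℝ E] : Type _ :=
  StrongDual ℝ (StrongDual ℝ E)

/-- The second transpose `T** : E** → F**`, that is `T** g = (ℓ ↦ g (ℓ ∘ T))`. -/
def bidualMap {E F : Type*} [NormedAddCommGroup E] [NormedSpace ℝ E]
    [NormedAddCommGroup F] [NormedSpace ℝ F] (T : E →L[ℝ] F) : Bidual E →L[ℝ] Bidual F :=
  ContinuousLinearMap.precomp ℝ (ContinuousLinearMap.precomp ℝ T)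

section L1

variable {Z : Type*} [MeasurableSpace Z] {π : Measure Z}

/-- The canonical embedding `L¹(π) → L¹(π)**`. -/
def toBidual (f : Lp ℝ 1 π) : Bidual (Lp ℝ 1 π) :=
  NormedSpace.inclusionInDoubleDual ℝ (Lp ℝ 1 π) f

/-- The order of the Banach lattice `L¹(π)**`: comparison on the positive functionals. -/
def BidualLE (g h : Bidual (Lp ℝ 1 π)) : Prop :=
  ∀ ℓ : StrongDual ℝ (Lp ℝ 1 π), (∀ f : Lp ℝ 1 π, 0 ≤ f → 0 ≤ ℓ f) → g ℓ ≤ h ℓ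

/-- `⟨h, π⟩`: the measure `π` is the constant `1` of `L^∞(π) = L¹(π)*`, i.e. integration. -/
def pairing (h : Bidual (Lp ℝ 1 π)) : ℝ :=
  h L1.integralCLM

/-- `g` is purely singular (purely finitely additive): it is a difference of two positive elements
neither of which dominates a nonzero positive element of `L¹(π)`. -/
def IsPurelySingular (g : Bidual (Lp ℝ 1 π)) : Prop :=
  ∃ g₁ g₂ : Bidual (Lp ℝ 1 π), g = g₁ - g₂ ∧ BidualLE 0 g₁ ∧ BidualLE 0 g₂ ∧
    (∀ f : Lp ℝ 1 π, 0 ≤ f → BidualLE (toBidual f) g₁ → f = 0) ∧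
    (∀ f : Lp ℝ 1 π, 0 ≤ f → BidualLE (toBidual f) g₂ → f = 0)

/-- `h = r + s` is the decomposition of `h` into its regular and purely singular parts. -/
def IsRegularSingular (h : Bidual (Lp ℝ 1 π)) (r : Lp ℝ 1 π) (s : Bidual (Lp ℝ 1 π)) : Prop :=
  h = toBidual r + s ∧ IsPurelySingular s

/-- The cost, finite `π`-almost everywhere when its integral is finite, as an element of
`L¹(π)`. -/
def costL1 (c : Z → ℝ≥0∞) (hc : Measurable c) (hπ : ∫⁻ z, c z ∂π ≠ ∞) : Lp ℝ 1 π :=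
  Integrable.toL1 (fun z => (c z).toReal)
    (integrable_toReal_of_lintegral_ne_top hc.aemeasurable hπ)

end L1

section L1S

variable {X Y : Type*} [MeasurableSpace X] [MeasurableSpace Y]

/-- `L¹_S(π)`: the closed span in `L¹(π)` of the functions `φ ⊕ ψ` with `φ ∈ L¹(μ)`,
`ψ ∈ L¹(ν)`. -/
def L1S (μ : Measure X) (ν : Measure Y) (π : Measure (X × Y)) : Submodule ℝ (Lp ℝ 1 π) :=
  (Submodule.span ℝ {f : Lp ℝ 1 π | ∃ (φ : X → ℝ) (ψ : Y → ℝ), Integrable φ μ ∧ Integrable ψ ν ∧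
    f =ᵐ[π] fun z => φ z.1 + ψ z.2}).topologicalClosure

/-- `L¹_S(π)**` as a subspace of `L¹(π)**`: the image of the second transpose of the inclusion
`L¹_S(π) → L¹(π)`. -/
def bidualL1S (μ : Measure X) (ν : Measure Y) (π : Measure (X × Y)) :
    Set (Bidual (Lp ℝ 1 π)) :=
  Set.range (bidualMap (L1S μ ν π).subtypeL)

/-- The feasible set of the bidual dual problem: `h ∈ L¹_S(π)**` with `h ≤ c` in `L¹(π)**`. -/
def bidualFeasible (μ : Measure X) (ν : Measure Y) (c : X × Y → ℝ≥0∞) (hc : Measurable c)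
    (π : Measure (X × Y)) (hπ : ∫⁻ z, c z ∂π ≠ ∞) : Set (Bidual (Lp ℝ 1 π)) :=
  {h | h ∈ bidualL1S μ ν π ∧ BidualLE h (toBidual (costL1 c hc hπ))}

/-- `D_{**}^(π)`, the value of the bidual dual problem. -/
def dualBidual (μ : Measure X) (ν : Measure Y) (c : X × Y → ℝ≥0∞) (hc : Measurable c)
    (π : Measure (X × Y)) (hπ : ∫⁻ z, c z ∂π ≠ ∞) : EReal :=
  ⨆ h ∈ bidualFeasible μ ν c hc π hπ, (pairing h : EReal)

end L1S

/-! ### Projections and the projective limit -/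

section Projection

variable {Z : Type*} [MeasurableSpace Z] {π₁ π₂ : Measure Z}

theorem PlanLE.le_smul [IsFiniteMeasure π₁] [IsFiniteMeasure π₂] (h : PlanLE π₁ π₂) :
    π₁ ≤ essSup (π₁.rnDeriv π₂) π₂ • π₂ := by
  conv_lhs => rw [← Measure.withDensity_rnDeriv_eq π₁ π₂ h.1]
  rw [← withDensity_const]
  exact withDensity_mono (ENNReal.ae_le_essSup _)

theorem PlanLE.memLp [IsFiniteMeasure π₁] [IsFiniteMeasure π₂] (h : PlanLE π₁ π₂)
    (f : Lp ℝ 1 π₂) : MemLp f 1 π₁ :=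
  (Lp.memLp f).of_measure_le_smul h.2.ne h.le_smul

/-- The projection `P_{π₁,π₂} : L¹(π₂) → L¹(π₁)` for `π₁ ⪯ π₂`: it sends the class of a function
modulo `π₂`-null functions to its class modulo `π₁`-null functions. -/
def proj [IsFiniteMeasure π₁] [IsFiniteMeasure π₂] (h : PlanLE π₁ π₂) :
    Lp ℝ 1 π₂ →L[ℝ] Lp ℝ 1 π₁ :=
  LinearMap.mkContinuous
    { toFun := fun f => (h.memLp f).toLp f
      map_add' := fun f g => by
        rw [← MemLp.toLp_add, MemLp.toLp_eq_toLp_iff]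
        exact h.1.ae_eq (Lp.coeFn_add f g)
      map_smul' := fun a f => by
        rw [RingHom.id_apply, ← MemLp.toLp_const_smul, MemLp.toLp_eq_toLp_iff]
        exact h.1.ae_eq (Lp.coeFn_smul a f) }
    (essSup (π₁.rnDeriv π₂) π₂).toReal
    (fun f => by
      simp only [LinearMap.coe_mk, AddHom.coe_mk]
      rw [Lp.norm_toLp, Lp.norm_def, ← ENNReal.toReal_mul]
      refine ENNReal.toReal_mono (ENNReal.mul_ne_top h.2.ne (Lp.eLpNorm_ne_top f)) ?_
      refine (eLpNorm_mono_measure f h.le_smul).trans ?_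
      rw [eLpNorm_one_smul_measure])

end Projection

section Limit

variable {X Y : Type*} [MeasurableSpace X] [MeasurableSpace Y]

/-- The index set of the limit: the finite-cost plans `π` with `π ⪰ π₀`. -/
abbrev PlansAbove (μ : Measure X) (ν : Measure Y) (c : X × Y → ℝ≥0∞) (π₀ : Measure (X × Y)) :
    Type _ :=
  {π : Measure (X × Y) // π ∈ finitePlans μ ν c ∧ PlanLE π₀ π}

instance plansAbove_isProbabilityMeasure {μ : Measure X} {ν : Measure Y} [IsProbabilityMeasure μ] {c : X × Y → ℝ≥0∞}
    {π₀ : Measure (X × Y)} (π : PlansAbove μ ν c π₀) : IsProbabilityMeasure π.1 :=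
  ⟨by rw [← Measure.fst_univ, π.2.1.1.1]; exact measure_univ⟩

/-- Membership in the projective limit of the spaces `L¹(π)**`, `π ⪰ π₀`, along the second
transposes of the projections `P_{π₁,π₂}`. -/
def IsProjectiveFamily {μ : Measure X} {ν : Measure Y} [IsProbabilityMeasure μ]
    {c : X × Y → ℝ≥0∞} {π₀ : Measure (X × Y)}
    (H : ∀ π : PlansAbove μ ν c π₀, Bidual (Lp ℝ 1 π.1)) : Prop :=
  ∀ (π₁ π₂ : PlansAbove μ ν c π₀) (h : PlanLE π₁.1 π₂.1), bidualMap (proj h) (H π₂) = H π₁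

end Limit

end

end TransportBidual

/-!
Fix `p = P^(π₀)`, the common value of all `P^(π)` with `π ⪰ π₀`. Functions that are integrable for
every such `π` form one space, and the duals of the spaces `L¹(π)` embed into its algebraic dual;
since any two plans lie below their average, the union of these duals is a directed union. On the
functionals in the union which agree with a multiple of a plan on all `φ ⊕ ψ`, the functional
`m ↦ m c - p m(1)` is nonnegative on the positive cone, because positive such functionals are
multiples of plans `⪯ π`, and these cost at least `p` times their mass. M. Riesz' extension theorem
extends it to a positive functional `k` on the whole union, and `ĥ_π = c - k` restricted to
`L¹(π)^*` is the required family. Since `k ≥ 0` and `c` is regular, the singular part of `ĥ_π` is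
nonpositive.

That `D^(π)` is at least `⟨ĥ_π, π⟩` is a Helly-type approximation: elements of `L¹(π)^**` below `c`
can be replaced by sums `φ ⊕ ψ` which exceed `c` by little in `L¹(π)`.
-/

namespace TransportBidual

noncomputable section

section Contents

variable {Z : Type*} [MeasurableSpace Z]

theorem isSetRing_measurableSet : IsSetRing {A : Set Z | MeasurableSet A} where
  empty_mem := .empty
  union_mem _ _ hA hB := hA.union hB
  sdiff_mem _ _ hA hB := hA.diff hB

theorem exists_measure_of_addContent_le (κ : Measure Z) [IsFiniteMeasure κ]
    (m : AddContent ℝ≥0∞ {A : Set Z | MeasurableSet A})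
    (hle : ∀ A, MeasurableSet A → m A ≤ κ A) :
    ∃ ρ ≤ κ, ∀ A, MeasurableSet A → ρ A = m A := by
  have htendsto : ∀ ⦃s : ℕ → Set Z⦄, (∀ n, MeasurableSet (s n)) → Antitone s →
      ⋂ n, s n = ∅ → Tendsto (fun n => m (s n)) atTop (𝓝 0) := fun s hs hanti hinter => by
    have hκ : Tendsto (fun n => κ (s n)) atTop (𝓝 0) := by
      simpa only [hinter, measure_empty, Function.comp_def] using tendsto_measure_iInter_atTop
        (fun n => (hs n).nullMeasurableSet) hanti ⟨0, measure_ne_top κ (s 0)⟩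
    exact tendsto_of_tendsto_of_tendsto_of_le_of_le tendsto_const_nhds hκ (fun _ => zero_le)
      fun n => hle _ (hs n)
  have hunion := addContent_iUnion_eq_sum_of_tendsto_zero isSetRing_measurableSet m
    (fun A hA => ((hle A hA).trans_lt (measure_lt_top κ A)).ne) htendsto
  have happly : ∀ A, MeasurableSet A → Measure.ofMeasurable (fun A _ => m A) addContent_empty
      (fun f hf hd => hunion hf (.iUnion hf) hd) A = m A := fun A hA =>
    Measure.ofMeasurable_apply A hA
  exact ⟨_, Measure.le_iff.2 fun A hA => (happly A hA).trans_le (hle A hA), happly⟩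

/-- The infimum of two contents: `A` is split into a part charged by `m₁` and a part charged
by `m₂`. -/
def contentInf (m₁ m₂ : AddContent ℝ≥0∞ {A : Set Z | MeasurableSet A}) :
    AddContent ℝ≥0∞ {A : Set Z | MeasurableSet A} :=
  isSetRing_measurableSet.addContent_of_union
    (fun A => ⨅ B : {B : Set Z // MeasurableSet B}, m₁ (A ∩ B) + m₂ (A \ B))
    (le_antisymm (iInf_le_of_le ⟨∅, .empty⟩ (by simp)) zero_le) <| by
  intro A₁ A₂ hA₁ hA₂ hd
  have hsplit (B : {B : Set Z // MeasurableSet B}) :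
      m₁ ((A₁ ∪ A₂) ∩ B) + m₂ ((A₁ ∪ A₂) \ B) =
        (m₁ (A₁ ∩ B) + m₂ (A₁ \ B)) + (m₁ (A₂ ∩ B) + m₂ (A₂ \ B)) := by
    rw [Set.union_inter_distrib_right, Set.union_sdiff_distrib,
      addContent_union isSetRing_measurableSet (hA₁.inter B.2) (hA₂.inter B.2)
        (hd.mono Set.inter_subset_left Set.inter_subset_left),
      addContent_union isSetRing_measurableSet (hA₁.diff B.2) (hA₂.diff B.2)
        (hd.mono Set.sdiff_subset Set.sdiff_subset), add_add_add_comm]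
  refine le_antisymm (ENNReal.le_iInf_add_iInf fun B₁ B₂ => ?_) (le_iInf fun B => ?_)
  · -- glue the two splittings along `A₁` and its complement
    refine iInf_le_of_le ⟨A₁ ∩ B₁ ∪ B₂ \ A₁, (hA₁.inter B₁.2).union (B₂.2.diff hA₁)⟩ ?_
    have hdisj := Set.disjoint_left.1 hd
    have h₁ : A₁ ∩ (A₁ ∩ B₁.1 ∪ B₂ \ A₁) = A₁ ∩ B₁ := by grind
    have h₂ : A₁ \ (A₁ ∩ B₁.1 ∪ B₂ \ A₁) = A₁ \ B₁ := by grind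
    have h₃ : A₂ ∩ (A₁ ∩ B₁.1 ∪ B₂ \ A₁) = A₂ ∩ B₂ := by grind
    have h₄ : A₂ \ (A₁ ∩ B₁.1 ∪ B₂ \ A₁) = A₂ \ B₂ := by grind
    rw [hsplit]
    simp only [h₁, h₂, h₃, h₄, le_refl]
  · rw [hsplit]
    exact add_le_add (iInf_le _ B) (iInf_le _ B)

theorem contentInf_le (m₁ m₂ : AddContent ℝ≥0∞ {A : Set Z | MeasurableSet A}) (A : Set Z)
    {B : Set Z} (hB : MeasurableSet B) : contentInf m₁ m₂ A ≤ m₁ (A ∩ B) + m₂ (A \ B) :=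
  iInf_le (fun B : {B : Set Z // MeasurableSet B} => m₁ (A ∩ B) + m₂ (A \ B)) ⟨B, hB⟩

theorem contentInf_lt_iff {m₁ m₂ : AddContent ℝ≥0∞ {A : Set Z | MeasurableSet A}} {A : Set Z}
    {t : ℝ≥0∞} :
    contentInf m₁ m₂ A < t ↔ ∃ B, MeasurableSet B ∧ m₁ (A ∩ B) + m₂ (A \ B) < t :=
  iInf_lt_iff.trans (by rw [Subtype.exists]; simp only [exists_prop])

end Contents

section Functionals

variable {Z : Type*} [MeasurableSpace Z] {π ρ : Measure Z}

theorem PlanLE.of_le_smul [IsFiniteMeasure ρ] [IsFiniteMeasure π] {C : ℝ≥0∞} (hC : C ≠ ∞)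
    (h : ρ ≤ C • π) : PlanLE ρ π := by
  refine ⟨Measure.absolutelyContinuous_of_le_smul h, (essSup_le_of_ae_le C ?_).trans_lt hC.lt_top⟩
  refine ae_le_of_forall_setLIntegral_le_of_sigmaFinite (Measure.measurable_rnDeriv _ _)
    fun s _ _ => ?_
  calc ∫⁻ z in s, ρ.rnDeriv π z ∂π ≤ ρ s := Measure.setLIntegral_rnDeriv_le s
    _ ≤ (C • π) s := h s
    _ = ∫⁻ _ in s, C ∂π := by rw [setLIntegral_const, Measure.smul_apply, smul_eq_mul]

theorem PlanLE.of_le [IsFiniteMeasure ρ] [IsFiniteMeasure π] (h : ρ ≤ π) : PlanLE ρ π :=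
  .of_le_smul ENNReal.one_ne_top (by rwa [one_smul])

theorem PlanLE.refl [IsFiniteMeasure π] : PlanLE π π :=
  .of_le le_rfl

theorem PlanLE.trans {π₁ π₂ π₃ : Measure Z} [IsFiniteMeasure π₁] [IsFiniteMeasure π₂]
    [IsFiniteMeasure π₃] (h₁ : PlanLE π₁ π₂) (h₂ : PlanLE π₂ π₃) : PlanLE π₁ π₃ := by
  refine .of_le_smul (ENNReal.mul_ne_top h₁.2.ne h₂.2.ne) (h₁.le_smul.trans ?_)
  rw [mul_smul]
  gcongr
  exact h₂.le_smul

theorem PlanLE.restrict [IsFiniteMeasure π] (A : Set Z) : PlanLE (π.restrict A) π :=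
  .of_le Measure.restrict_le_self

theorem PlanLE.integrable [IsFiniteMeasure ρ] [IsFiniteMeasure π] (h : PlanLE ρ π)
    (f : Lp ℝ 1 π) : Integrable f ρ :=
  memLp_one_iff_integrable.1 (h.memLp f)

/-- Integration against a measure with bounded density, as an element of `L¹(π)*`. -/
def integralDual [IsFiniteMeasure ρ] [IsFiniteMeasure π] (h : PlanLE ρ π) :
    StrongDual ℝ (Lp ℝ 1 π) :=
  L1.integralCLM.comp (proj h)

theorem integralCLM_apply (f : Lp ℝ 1 π) :
    (L1.integralCLM : StrongDual ℝ (Lp ℝ 1 π)) f = ∫ z, f z ∂π := by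
  rw [← L1.integral_eq, L1.integral_eq_integral]

theorem integralDual_apply [IsFiniteMeasure ρ] [IsFiniteMeasure π] (h : PlanLE ρ π)
    (f : Lp ℝ 1 π) : integralDual h f = ∫ z, f z ∂ρ :=
  (integralCLM_apply _).trans (integral_congr_ae (MemLp.coeFn_toLp (h.memLp f)))

theorem integralDual_comp_proj {π₁ π₂ : Measure Z} [IsFiniteMeasure ρ] [IsFiniteMeasure π₁]
    [IsFiniteMeasure π₂] (h₁ : PlanLE ρ π₁) (h₂ : PlanLE π₁ π₂) :
    (integralDual h₁).comp (proj h₂) = integralDual (h₁.trans h₂) := by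
  ext f
  rw [ContinuousLinearMap.comp_apply, integralDual_apply, integralDual_apply]
  exact integral_congr_ae (h₁.1.ae_eq (MemLp.coeFn_toLp (h₂.memLp f)))

theorem integralDual_refl [IsFiniteMeasure π] :
    integralDual (PlanLE.refl (π := π)) = L1.integralCLM := by
  ext f
  rw [integralDual_apply, integralCLM_apply]

/-- The positive cone of the dual of `L¹(π)`. -/
def IsNonneg (ℓ : StrongDual ℝ (Lp ℝ 1 π)) : Prop :=
  ∀ f : Lp ℝ 1 π, 0 ≤ f → 0 ≤ ℓ f

theorem isNonneg_integralDual [IsFiniteMeasure ρ] [IsFiniteMeasure π] (h : PlanLE ρ π) :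
    IsNonneg (integralDual h) := fun f hf => by
  rw [integralDual_apply]
  exact integral_nonneg_of_ae (h.1.ae_le ((Lp.coeFn_nonneg f).2 hf))

theorem isNonneg_integralCLM : IsNonneg (L1.integralCLM : StrongDual ℝ (Lp ℝ 1 π)) :=
  fun f hf => by
    rw [integralCLM_apply]
    exact integral_nonneg_of_ae ((Lp.coeFn_nonneg f).2 hf)

theorem norm_eq_integral_of_nonneg {f : Lp ℝ 1 π} (hf : 0 ≤ f) : ‖f‖ = ∫ z, f z ∂π := by
  rw [L1.norm_eq_integral_norm]
  refine integral_congr_ae ?_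
  filter_upwards [(Lp.coeFn_nonneg f).2 hf] with z hz
  exact Real.norm_of_nonneg hz

theorem indicatorConstLp_one_nonneg {A : Set Z} (hA : MeasurableSet A) (hπA : π A ≠ ∞) :
    0 ≤ indicatorConstLp 1 hA hπA (1 : ℝ) := by
  rw [← Lp.coeFn_nonneg]
  filter_upwards [indicatorConstLp_coeFn (p := 1) (hs := hA) (hμs := hπA) (c := (1 : ℝ))] with z hz
  exact (Set.indicator_nonneg (fun _ _ => zero_le_one) z).trans_eq hz.symm

theorem dual_ext_indicator {ℓ ℓ' : StrongDual ℝ (Lp ℝ 1 π)}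
    (h : ∀ (A : Set Z) (hA : MeasurableSet A) (hπA : π A ≠ ∞),
      ℓ (indicatorConstLp 1 hA hπA 1) = ℓ' (indicatorConstLp 1 hA hπA 1)) : ℓ = ℓ' := by
  ext f
  refine Lp.induction ENNReal.one_ne_top (motive := fun f => ℓ f = ℓ' f) ?_ ?_ ?_ f
  · intro a A hA hπA
    have hsmul : indicatorConstLp 1 hA hπA.ne a = a • indicatorConstLp 1 hA hπA.ne (1 : ℝ) := by
      rw [indicatorConstLp, indicatorConstLp, ← MemLp.toLp_const_smul]
      congr 1
      ext z
      simp [Set.indicator]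
    rw [Lp.simpleFunc.coe_indicatorConst, hsmul, map_smul, map_smul, h]
  · intro f g hf hg _ h₁ h₂
    rw [map_add, map_add, h₁, h₂]
  · exact isClosed_eq ℓ.continuous ℓ'.continuous

theorem IsNonneg.exists_measure_apply_indicator [IsFiniteMeasure π]
    {ℓ : StrongDual ℝ (Lp ℝ 1 π)} (hℓ : IsNonneg ℓ) :
    ∃ ρ ≤ ENNReal.ofReal ‖ℓ‖ • π, ∀ (A : Set Z) (hA : MeasurableSet A),
      ρ.real A = ℓ (indicatorConstLp 1 hA (measure_ne_top π A) 1) := by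
  classical
  have hnonneg (A : Set Z) (hA : MeasurableSet A) :
      0 ≤ ℓ (indicatorConstLp 1 hA (measure_ne_top π A) 1) :=
    hℓ _ (indicatorConstLp_one_nonneg hA _)
  let value (A : Set Z) : ℝ≥0∞ := if hA : MeasurableSet A then
    ENNReal.ofReal (ℓ (indicatorConstLp 1 hA (measure_ne_top π A) 1)) else 0
  have hvalue {A : Set Z} (hA : MeasurableSet A) :
      value A = ENNReal.ofReal (ℓ (indicatorConstLp 1 hA (measure_ne_top π A) 1)) := dif_pos hA
  let m := isSetRing_measurableSet.addContent_of_union value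
    (by rw [hvalue .empty, indicatorConstLp_empty, map_zero, ENNReal.ofReal_zero])
    (fun {A B} hA hB hAB => by
      rw [hvalue hA, hvalue hB, hvalue (hA.union hB),
        ← ENNReal.ofReal_add (hnonneg A hA) (hnonneg B hB), ← map_add,
        indicatorConstLp_disjoint_union hA hB (measure_ne_top π A) (measure_ne_top π B) hAB])
  have hfin : IsFiniteMeasure (ENNReal.ofReal ‖ℓ‖ • π) :=
    Measure.smul_finite π ENNReal.ofReal_ne_top
  obtain ⟨ρ, hρ, hρm⟩ := exists_measure_of_addContent_le (ENNReal.ofReal ‖ℓ‖ • π) m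
    fun A hA => by
      calc m A = ENNReal.ofReal (ℓ (indicatorConstLp 1 hA (measure_ne_top π A) 1)) := hvalue hA
        _ ≤ ENNReal.ofReal (‖ℓ‖ * π.real A) := by
          refine ENNReal.ofReal_le_ofReal ((le_abs_self _).trans ((ℓ.le_opNorm _).trans_eq ?_))
          rw [norm_indicatorConstLp one_ne_zero ENNReal.one_ne_top]
          simp
        _ = (ENNReal.ofReal ‖ℓ‖ • π) A := by
          rw [ENNReal.ofReal_mul (norm_nonneg _), ofReal_measureReal, Measure.smul_apply,
            smul_eq_mul]
  refine ⟨ρ, hρ, fun A hA => ?_⟩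
  rw [measureReal_def, hρm A hA]
  exact (congrArg ENNReal.toReal (hvalue hA)).trans (ENNReal.toReal_ofReal (hnonneg A hA))

theorem IsNonneg.exists_eq_integralDual [IsFiniteMeasure π] {ℓ : StrongDual ℝ (Lp ℝ 1 π)}
    (hℓ : IsNonneg ℓ) :
    ∃ (ρ : Measure Z) (_ : IsFiniteMeasure ρ) (h : PlanLE ρ π), ℓ = integralDual h := by
  obtain ⟨ρ, hρ, hindicator⟩ := hℓ.exists_measure_apply_indicator
  have hfin : IsFiniteMeasure (ENNReal.ofReal ‖ℓ‖ • π) :=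
    Measure.smul_finite π ENNReal.ofReal_ne_top
  have : IsFiniteMeasure ρ := isFiniteMeasure_of_le _ hρ
  have hle : PlanLE ρ π := .of_le_smul ENNReal.ofReal_ne_top hρ
  refine ⟨ρ, this, hle, dual_ext_indicator fun A hA hπA => ?_⟩
  rw [← hindicator A hA, integralDual_apply, integral_congr_ae (hle.1.ae_eq indicatorConstLp_coeFn),
    integral_indicator hA, setIntegral_const, smul_eq_mul, mul_one]

end Functionals

section BidualOrder

variable {Z : Type*} [MeasurableSpace Z] {π ρ : Measure Z} {k g h : Bidual (Lp ℝ 1 π)}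

theorem bidualLE_sub_iff : BidualLE k (h - g) ↔ BidualLE (k + g) h :=
  forall₂_congr fun _ _ => le_sub_iff_add_le

theorem bidualLE_zero_sub : BidualLE 0 (h - g) ↔ BidualLE g h := by
  rw [bidualLE_sub_iff, zero_add]

theorem bidualLE_zero_toBidual {f : Lp ℝ 1 π} (hf : 0 ≤ f) : BidualLE 0 (toBidual f) :=
  fun _ hℓ => hℓ f hf

theorem toBidual_zero : toBidual (0 : Lp ℝ 1 π) = 0 := map_zero _

theorem toBidual_add (f g : Lp ℝ 1 π) : toBidual (f + g) = toBidual f + toBidual g :=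
  ContinuousLinearMap.ext fun ℓ => map_add ℓ f g

theorem toBidual_sub (f g : Lp ℝ 1 π) : toBidual (f - g) = toBidual f - toBidual g :=
  ContinuousLinearMap.ext fun ℓ => map_sub ℓ f g

theorem toBidual_neg (f : Lp ℝ 1 π) : toBidual (-f) = -toBidual f :=
  ContinuousLinearMap.ext fun ℓ => map_neg ℓ f

theorem pairing_toBidual (f : Lp ℝ 1 π) : pairing (toBidual f) = ∫ z, f z ∂π :=
  integralCLM_apply f

theorem pairing_mono (H : BidualLE g h) : pairing g ≤ pairing h :=
  H _ isNonneg_integralCLM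

theorem isClosed_setOf_toBidual_le (k : Bidual (Lp ℝ 1 π)) :
    IsClosed {f : Lp ℝ 1 π | BidualLE (toBidual f) k} := by
  simp only [BidualLE, Set.ofPred_forall]
  exact isClosed_iInter fun ℓ => isClosed_iInter fun _ => isClosed_le ℓ.continuous continuous_const

variable [IsFiniteMeasure π]

theorem bidualLE_iff_integralDual :
    BidualLE g h ↔ ∀ (ρ : Measure Z) [IsFiniteMeasure ρ] (hρ : PlanLE ρ π),
      g (integralDual hρ) ≤ h (integralDual hρ) := by
  refine ⟨fun H ρ _ hρ => H _ (isNonneg_integralDual hρ), fun H ℓ hℓ => ?_⟩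
  obtain ⟨ρ, _, hρ, rfl⟩ := IsNonneg.exists_eq_integralDual hℓ
  exact H ρ hρ

/-- The value on a set of an element of `L¹(π)**`, seen as a finitely additive measure. -/
def setVal (k : Bidual (Lp ℝ 1 π)) (A : Set Z) : ℝ :=
  k (integralDual (PlanLE.restrict A))

theorem setVal_toBidual (f : Lp ℝ 1 π) (A : Set Z) : setVal (toBidual f) A = ∫ z in A, f z ∂π :=
  integralDual_apply _ f

theorem setVal_union (k : Bidual (Lp ℝ 1 π)) {A B : Set Z} (hB : MeasurableSet B)
    (hAB : Disjoint A B) : setVal k (A ∪ B) = setVal k A + setVal k B := by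
  rw [setVal, setVal, setVal, ← map_add]
  congr 1
  ext f
  rw [add_apply, integralDual_apply, integralDual_apply, integralDual_apply]
  have hf : Integrable f π := PlanLE.refl.integrable f
  exact setIntegral_union hAB hB hf.integrableOn hf.integrableOn

theorem setVal_inter_add_sdiff (k : Bidual (Lp ℝ 1 π)) {A B : Set Z} (hA : MeasurableSet A)
    (hB : MeasurableSet B) : setVal k (A ∩ B) + setVal k (A \ B) = setVal k A := by
  rw [← setVal_union k (hA.diff hB) Set.disjoint_sdiff_inter.symm, Set.inter_union_sdiff]

theorem setVal_empty (k : Bidual (Lp ℝ 1 π)) : setVal k ∅ = 0 := by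
  simpa using setVal_union k MeasurableSet.empty (Set.disjoint_empty (∅ : Set Z))

theorem setVal_nonneg (hk : BidualLE 0 k) (A : Set Z) : 0 ≤ setVal k A :=
  hk _ (isNonneg_integralDual _)

theorem setVal_mono (hk : BidualLE 0 k) {A B : Set Z} (hA : MeasurableSet A)
    (hB : MeasurableSet B) (hAB : A ⊆ B) : setVal k A ≤ setVal k B := by
  rw [← setVal_inter_add_sdiff k hB hA, Set.inter_eq_self_of_subset_right hAB]
  exact le_add_of_nonneg_right (setVal_nonneg hk _)

theorem norm_integralDual_le [IsFiniteMeasure ρ] (hρ : PlanLE ρ π) {C : NNReal}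
    (hC : ρ ≤ C • π) : ‖integralDual hρ‖ ≤ C := by
  refine ContinuousLinearMap.opNorm_le_bound _ C.2 fun f => ?_
  have hf : Integrable f π := PlanLE.refl.integrable f
  calc ‖integralDual hρ f‖ ≤ ∫ z, ‖f z‖ ∂ρ := by
        rw [integralDual_apply]
        exact norm_integral_le_integral_norm _
    _ ≤ ∫ z, ‖f z‖ ∂(C • π) := integral_mono_measure hC
        (Eventually.of_forall fun z => norm_nonneg (f z)) hf.norm.smul_measure_nnreal
    _ = C * ‖f‖ := by
        rw [integral_smul_nnreal_measure, L1.norm_eq_integral_norm, NNReal.smul_def, smul_eq_mul]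

theorem exists_add_self_eq_add_restrict {κ : Measure Z} [IsFiniteMeasure ρ] [IsFiniteMeasure κ]
    (hρ : ρ ≤ κ) :
    ∃ A, MeasurableSet A ∧ ∃ ρ' ≤ κ, ρ + ρ = ρ' + κ.restrict A := by
  obtain ⟨A, hA⟩ := exists_isHahnDecomposition κ (ρ + ρ)
  have hle : κ.restrict A ≤ ρ + ρ := hA.le_on.trans Measure.restrict_le_self
  refine ⟨A, hA.measurableSet, ρ + ρ - κ.restrict A, Measure.sub_le_of_le_add ?_,
    (Measure.sub_add_cancel_of_le hle).symm⟩
  calc ρ + ρ = (ρ + ρ).restrict A + (ρ + ρ).restrict Aᶜ :=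
        (Measure.restrict_add_restrict_compl hA.measurableSet).symm
    _ ≤ (κ + κ).restrict A + κ.restrict Aᶜ :=
        add_le_add (Measure.restrict_mono_measure (add_le_add hρ hρ) A) hA.ge_on_compl
    _ = κ + κ.restrict A := by
        rw [Measure.restrict_add, add_right_comm,
          Measure.restrict_add_restrict_compl hA.measurableSet]

-- Each step subtracts the indicator of a set from twice the functional without leaving the
-- interval between `0` and `C` times integration: the binary expansion of the density.
theorem neg_le_apply_integralDual (hk : ∀ A, MeasurableSet A → 0 ≤ setVal k A) (C : NNReal)
    (n : ℕ) : ∀ {ρ : Measure Z} [IsFiniteMeasure ρ] (hρ : PlanLE ρ π), ρ ≤ C • π →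
      -(‖k‖ * C / 2 ^ n) ≤ k (integralDual hρ) := by
  induction n with
  | zero =>
    intro ρ _ hρ hC
    rw [pow_zero, div_one]
    exact (abs_le.1 ((k.le_opNorm _).trans
      (mul_le_mul_of_nonneg_left (norm_integralDual_le hρ hC) (norm_nonneg k)))).1
  | succ n ih =>
    intro ρ _ hρ hC
    obtain ⟨A, hA, ρ', hρ', hadd⟩ := exists_add_self_eq_add_restrict hC
    have : IsFiniteMeasure ρ' := isFiniteMeasure_of_le _ hρ'
    have hρ'π : PlanLE ρ' π := .of_le_smul ENNReal.coe_ne_top hρ'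
    have hdual : integralDual hρ + integralDual hρ =
        integralDual hρ'π + C • integralDual (PlanLE.restrict A) := by
      ext f
      rw [add_apply, add_apply, smul_apply, integralDual_apply,
        integralDual_apply, integralDual_apply,
        ← integral_add_measure (hρ.integrable f) (hρ.integrable f), hadd, Measure.restrict_smul,
        integral_add_measure (hρ'π.integrable f)
          ((PlanLE.restrict A).integrable f).smul_measure_nnreal,
        integral_smul_nnreal_measure]
    have hk₂ := congrArg k hdual
    rw [map_add, map_add, NNReal.smul_def, map_smul, smul_eq_mul] at hk₂
    have hprod : 0 ≤ (C : ℝ) * k (integralDual (PlanLE.restrict A)) := mul_nonneg C.2 (hk A hA)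
    have hpow : ‖k‖ * C / 2 ^ n = 2 * (‖k‖ * C / 2 ^ (n + 1)) := by
      rw [pow_succ]
      field_simp
    linarith [ih hρ'π hρ']

theorem bidualLE_iff_setVal :
    BidualLE g h ↔ ∀ A, MeasurableSet A → setVal g A ≤ setVal h A := by
  refine ⟨fun H A _ => H _ (isNonneg_integralDual _), fun H => bidualLE_zero_sub.1 <|
    bidualLE_iff_integralDual.2 fun ρ _ hρ => ?_⟩
  have hle : ρ ≤ (essSup (ρ.rnDeriv π) π).toNNReal • π := by
    have := hρ.le_smul
    rwa [← ENNReal.coe_toNNReal hρ.2.ne] at this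
  have htendsto : Tendsto (fun n : ℕ => -(‖h - g‖ * (essSup (ρ.rnDeriv π) π).toNNReal / 2 ^ n))
      atTop (𝓝 0) := by
    simpa only [neg_zero] using (tendsto_const_nhds.div_atTop
      (tendsto_pow_atTop_atTop_of_one_lt (one_lt_two : (1 : ℝ) < 2))).neg
  exact le_of_tendsto' htendsto fun n =>
    neg_le_apply_integralDual (k := h - g) (fun A hA => sub_nonneg.2 (H A hA)) _ n hρ hle

theorem toBidual_sup_le {f g : Lp ℝ 1 π} (hf : BidualLE (toBidual f) k)
    (hg : BidualLE (toBidual g) k) : BidualLE (toBidual (f ⊔ g)) k := by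
  rw [bidualLE_iff_setVal] at *
  intro A hA
  have hS : MeasurableSet {z | f z ≤ g z} :=
    measurableSet_le (Lp.stronglyMeasurable f).measurable (Lp.stronglyMeasurable g).measurable
  have hval_right : setVal (toBidual (f ⊔ g)) (A ∩ {z | f z ≤ g z}) =
      setVal (toBidual g) (A ∩ {z | f z ≤ g z}) := by
    rw [setVal_toBidual, setVal_toBidual]
    refine setIntegral_congr_ae (hA.inter hS) ?_
    filter_upwards [Lp.coeFn_sup f g] with z hz hzS
    rw [hz, Pi.sup_apply]
    exact sup_eq_right.2 hzS.2
  have hval_left : setVal (toBidual (f ⊔ g)) (A \ {z | f z ≤ g z}) =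
      setVal (toBidual f) (A \ {z | f z ≤ g z}) := by
    rw [setVal_toBidual, setVal_toBidual]
    refine setIntegral_congr_ae (hA.diff hS) ?_
    filter_upwards [Lp.coeFn_sup f g] with z hz hzS
    rw [hz, Pi.sup_apply]
    exact sup_eq_left.2 (le_of_not_ge hzS.2)
  rw [← setVal_inter_add_sdiff _ hA hS, ← setVal_inter_add_sdiff k hA hS, hval_right, hval_left]
  exact add_le_add (hg _ (hA.inter hS)) (hf _ (hA.diff hS))

end BidualOrder

section Decomposition

variable {Z : Type*} [MeasurableSpace Z] {π : Measure Z}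

theorem norm_sub_of_le {f g : Lp ℝ 1 π} (h : f ≤ g) :
    ‖g - f‖ = pairing (toBidual g) - pairing (toBidual f) := by
  rw [norm_eq_integral_of_nonneg (sub_nonneg.2 h), ← pairing_toBidual, toBidual_sub]
  rfl

theorem exists_tendsto_of_monotone {u : ℕ → Lp ℝ 1 π} (hu : Monotone u)
    (hbdd : BddAbove (Set.range fun n => pairing (toBidual (u n)))) :
    ∃ r, Tendsto u atTop (𝓝 r) := by
  have hdist (m n : ℕ) :
      dist (u m) (u n) = dist (pairing (toBidual (u m))) (pairing (toBidual (u n))) := by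
    wlog hmn : m ≤ n generalizing m n
    · rw [dist_comm, this n m (le_of_not_ge hmn), dist_comm]
    rw [dist_comm, dist_eq_norm, norm_sub_of_le (hu hmn), dist_comm, Real.dist_eq,
      ← norm_sub_of_le (hu hmn), abs_norm]
  have hmono : Monotone fun n => pairing (toBidual (u n)) := fun m n hmn =>
    sub_nonneg.1 ((norm_nonneg _).trans_eq (norm_sub_of_le (hu hmn)))
  have hcauchy := (tendsto_atTop_ciSup hmono hbdd).cauchySeq
  refine cauchySeq_tendsto_of_complete ?_
  rw [Metric.cauchySeq_iff] at hcauchy ⊢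
  simpa only [hdist] using hcauchy

theorem exists_isGreatest_of_isClosed {S : Set (Lp ℝ 1 π)} (hne : S.Nonempty) (hS : IsClosed S)
    (hsup : SupClosed S) (hbdd : BddAbove ((fun f => pairing (toBidual f)) '' S)) :
    ∃ r, IsGreatest S r := by
  set I : Lp ℝ 1 π → ℝ := fun f => pairing (toBidual f)
  have hmono : Monotone I := fun f g hfg =>
    sub_nonneg.1 ((norm_nonneg _).trans_eq (norm_sub_of_le hfg))
  obtain ⟨v, -, hv, hvS⟩ := exists_seq_tendsto_sSup (hne.image I) hbdd
  choose u huS huv using hvS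
  have hmem (n : ℕ) : partialSups u n ∈ S := by
    induction n with
    | zero => exact huS 0
    | succ n ih =>
      rw [partialSups_add_one]
      exact hsup ih (huS _)
  obtain ⟨r, hr⟩ := exists_tendsto_of_monotone (partialSups u).monotone
    (hbdd.mono (Set.range_subset_iff.2 fun n => Set.mem_image_of_mem I (hmem n)))
  have hrS : r ∈ S := hS.mem_of_tendsto hr (Eventually.of_forall hmem)
  have hcont : Continuous I := (L1.integralCLM : StrongDual ℝ (Lp ℝ 1 π)).continuous
  have hIr : sSup (I '' S) ≤ I r := le_of_tendsto_of_tendsto' hv ((hcont.tendsto r).comp hr)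
    fun n => (huv n).symm.trans_le (hmono (le_partialSups u n))
  refine ⟨r, hrS, fun f hf => ?_⟩
  have hle : I (f ⊔ r) ≤ I r := (le_csSup hbdd ⟨_, hsup hf hrS, rfl⟩).trans hIr
  have hnorm : ‖f ⊔ r - r‖ ≤ 0 := (norm_sub_of_le le_sup_right).trans_le (sub_nonpos.2 hle)
  exact le_sup_left.trans_eq (sub_eq_zero.1 (norm_le_zero_iff.1 hnorm))

variable {a b h : Bidual (Lp ℝ 1 π)}

/-- The positive elements of `L¹(π)**` disjoint from `L¹(π)`; `IsPurelySingular` elements are the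
differences of two of them. -/
def IsSingular (a : Bidual (Lp ℝ 1 π)) : Prop :=
  BidualLE 0 a ∧ ∀ f : Lp ℝ 1 π, 0 ≤ f → BidualLE (toBidual f) a → f = 0

theorem isSingular_zero : IsSingular (0 : Bidual (Lp ℝ 1 π)) := by
  refine ⟨fun _ _ => le_rfl, fun f hf hf0 => norm_le_zero_iff.1 ?_⟩
  rw [norm_eq_integral_of_nonneg hf, ← pairing_toBidual]
  exact pairing_mono hf0

theorem isPurelySingular_iff :
    IsPurelySingular h ↔ ∃ a b, IsSingular a ∧ IsSingular b ∧ h = a - b := by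
  simp only [IsPurelySingular, IsSingular]
  grind

variable [IsFiniteMeasure π]

theorem exists_isGreatest_toBidual_le (ha : BidualLE 0 a) :
    ∃ r, IsGreatest {f : Lp ℝ 1 π | BidualLE (toBidual f) a} r :=
  exists_isGreatest_of_isClosed ⟨0, by simpa only [Set.mem_ofPred_eq, toBidual_zero] using ha⟩
    (isClosed_setOf_toBidual_le a) (fun _ hf _ hg => toBidual_sup_le hf hg)
    ⟨pairing a, Set.forall_mem_image.2 fun _ hf => pairing_mono hf⟩

/-- The content `A ↦ k(A)` of a positive element of `L¹(π)**`. -/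
def setContent (k : Bidual (Lp ℝ 1 π)) (hk : BidualLE 0 k) :
    AddContent ℝ≥0∞ {A : Set Z | MeasurableSet A} :=
  isSetRing_measurableSet.addContent_of_union (fun A => ENNReal.ofReal (setVal k A))
    (by rw [setVal_empty, ENNReal.ofReal_zero])
    (fun _ hB hAB => by
      rw [setVal_union k hB hAB, ENNReal.ofReal_add (setVal_nonneg hk _) (setVal_nonneg hk _)])

theorem setContent_apply (ha : BidualLE 0 a) (A : Set Z) :
    setContent a ha A = ENNReal.ofReal (setVal a A) := rfl

theorem exists_setVal_toBidual_eq {f : Lp ℝ 1 π} (hf : 0 ≤ f)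
    (m : AddContent ℝ≥0∞ {A : Set Z | MeasurableSet A})
    (hm : ∀ A, MeasurableSet A → m A ≤ ENNReal.ofReal (setVal (toBidual f) A)) :
    ∃ d : Lp ℝ 1 π, 0 ≤ d ∧ ∀ A, MeasurableSet A → setVal (toBidual d) A = (m A).toReal := by
  have hfπ : Integrable f π := PlanLE.refl.integrable f
  have : IsFiniteMeasure (π.withDensity fun z => ENNReal.ofReal (f z)) :=
    isFiniteMeasure_withDensity_ofReal hfπ.2
  obtain ⟨ρ, hρf, hρ⟩ := exists_measure_of_addContent_le
    (π.withDensity fun z => ENNReal.ofReal (f z)) m fun A hA => by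
      refine (hm A hA).trans_eq ?_
      rw [setVal_toBidual, withDensity_apply _ hA,
        ofReal_integral_eq_lintegral_ofReal hfπ.integrableOn
          (ae_restrict_of_ae ((Lp.coeFn_nonneg f).2 hf))]
  have : IsFiniteMeasure ρ := isFiniteMeasure_of_le _ hρf
  have hρπ : ρ ≪ π :=
    (Measure.absolutelyContinuous_of_le hρf).trans (withDensity_absolutelyContinuous _ _)
  have hint : Integrable (fun z => (ρ.rnDeriv π z).toReal) π := Measure.integrable_toReal_rnDeriv
  refine ⟨hint.toL1, ?_, fun A hA => ?_⟩
  · rw [← Lp.coeFn_nonneg]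
    filter_upwards [hint.coeFn_toL1] with z hz
    exact ENNReal.toReal_nonneg.trans_eq hz.symm
  · rw [setVal_toBidual, integral_congr_ae (ae_restrict_of_ae hint.coeFn_toL1),
      Measure.setIntegral_toReal_rnDeriv hρπ, measureReal_def, hρ A hA]

theorem IsSingular.exists_setVal_lt (ha : IsSingular a) {f : Lp ℝ 1 π} (hf : 0 ≤ f) {ε : ℝ}
    (hε : 0 < ε) :
    ∃ B, MeasurableSet B ∧ setVal a B < ε ∧ setVal (toBidual f) Bᶜ < ε := by
  let m := contentInf (setContent a ha.1) (setContent _ (bidualLE_zero_toBidual hf))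
  have hmf (A : Set Z) : m A ≤ ENNReal.ofReal (setVal (toBidual f) A) :=
    (contentInf_le _ _ A .empty).trans_eq (by simp [setContent_apply])
  have hma (A : Set Z) : m A ≤ ENNReal.ofReal (setVal a A) :=
    (contentInf_le _ _ A .univ).trans_eq (by simp [setContent_apply])
  obtain ⟨d, hd, hdm⟩ := exists_setVal_toBidual_eq hf m fun A _ => hmf A
  have hd0 : d = 0 := ha.2 d hd <| bidualLE_iff_setVal.2 fun A hA => by
    rw [hdm A hA]
    exact ENNReal.toReal_le_of_le_ofReal (setVal_nonneg ha.1 A) (hma A)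
  have huniv : m Set.univ < ENNReal.ofReal ε := by
    have htop : m Set.univ ≠ ∞ := ne_top_of_le_ne_top ENNReal.ofReal_ne_top (hma _)
    rw [← ENNReal.ofReal_toReal htop, ← hdm _ .univ, hd0, toBidual_zero]
    exact (ENNReal.ofReal_lt_ofReal_iff hε).2 hε
  obtain ⟨B, hB, hlt⟩ := contentInf_lt_iff.1 huniv
  rw [setContent_apply, setContent_apply, Set.univ_inter, ← Set.compl_eq_univ_sdiff] at hlt
  exact ⟨B, hB, (ENNReal.ofReal_lt_ofReal_iff hε).1 (le_self_add.trans_lt hlt),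
    (ENNReal.ofReal_lt_ofReal_iff hε).1 (le_add_self.trans_lt hlt)⟩

theorem IsSingular.add (ha : IsSingular a) (hb : IsSingular b) : IsSingular (a + b) := by
  refine ⟨fun ℓ hℓ => add_nonneg (ha.1 ℓ hℓ) (hb.1 ℓ hℓ), fun f hf hfab => ?_⟩
  have hf0 := bidualLE_zero_toBidual hf
  refine norm_le_zero_iff.1 (le_of_forall_pos_le_add fun ε hε => ?_)
  obtain ⟨A, hA, haA, hfA⟩ := ha.exists_setVal_lt hf (show 0 < ε / 4 by positivity)
  obtain ⟨B, hB, hbB, hfB⟩ := hb.exists_setVal_lt hf (show 0 < ε / 4 by positivity)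
  have hnorm : ‖f‖ = setVal (toBidual f) Set.univ := by
    rw [norm_eq_integral_of_nonneg hf, setVal_toBidual, setIntegral_univ]
  have hsplitA := setVal_inter_add_sdiff (toBidual f) .univ hA
  have hsplitB := setVal_inter_add_sdiff (toBidual f) hA hB
  have hAB : setVal (toBidual f) (A ∩ B) ≤ setVal a (A ∩ B) + setVal b (A ∩ B) :=
    bidualLE_iff_setVal.1 hfab _ (hA.inter hB)
  have haAB := setVal_mono ha.1 (hA.inter hB) hA Set.inter_subset_left
  have hbAB := setVal_mono hb.1 (hA.inter hB) hB Set.inter_subset_right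
  have hfAB := setVal_mono hf0 (hA.diff hB) hB.compl (Set.sdiff_subset_compl A B)
  rw [Set.univ_inter, ← Set.compl_eq_univ_sdiff] at hsplitA
  linarith

theorem IsSingular.nonpos_of_toBidual_le (ha : IsSingular a) {f : Lp ℝ 1 π}
    (hf : BidualLE (toBidual f) a) : f ≤ 0 := by
  rw [← sup_eq_right]
  refine ha.2 _ le_sup_right (toBidual_sup_le hf ?_)
  rw [toBidual_zero]
  exact ha.1

theorem IsSingular.eq_zero_of_toBidual_eq_sub (ha : IsSingular a) (hb : IsSingular b)
    {f : Lp ℝ 1 π} (hf : toBidual f = a - b) : f = 0 := by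
  refine le_antisymm (ha.nonpos_of_toBidual_le ?_) (neg_nonpos.1 (hb.nonpos_of_toBidual_le ?_))
  · rw [hf]
    exact fun ℓ hℓ => sub_le_self _ (hb.1 ℓ hℓ)
  · rw [toBidual_neg, hf]
    exact fun ℓ hℓ => (neg_sub _ _).trans_le (sub_le_self _ (ha.1 ℓ hℓ))

theorem IsRegularSingular.unique {r r' : Lp ℝ 1 π} {s s' : Bidual (Lp ℝ 1 π)}
    (H : IsRegularSingular h r s) (H' : IsRegularSingular h r' s') : r = r' ∧ s = s' := by
  obtain ⟨hrs, hs⟩ := H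
  obtain ⟨hrs', hs'⟩ := H'
  obtain ⟨a, b, ha, hb, rfl⟩ := isPurelySingular_iff.1 hs
  obtain ⟨a', b', ha', hb', rfl⟩ := isPurelySingular_iff.1 hs'
  have hdiff : toBidual (r - r') = (a' + b) - (b' + a) := by
    ext ℓ
    have hℓ := DFunLike.congr_fun (hrs.symm.trans hrs') ℓ
    simp only [toBidual_sub, add_apply, sub_apply] at hℓ ⊢
    linarith
  obtain rfl : r = r' := sub_eq_zero.1 ((ha'.add hb).eq_zero_of_toBidual_eq_sub (hb'.add ha) hdiff)
  exact ⟨rfl, ContinuousLinearMap.ext fun ℓ =>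
    add_left_cancel (DFunLike.congr_fun (hrs.symm.trans hrs') ℓ)⟩

theorem exists_isRegularSingular_of_le {c : Lp ℝ 1 π} (hc : BidualLE h (toBidual c)) :
    ∃ r s, r ≤ c ∧ BidualLE s 0 ∧ IsRegularSingular h r s := by
  obtain ⟨q, hq, hmax⟩ := exists_isGreatest_toBidual_le (bidualLE_zero_sub.2 hc)
  have hq0 : 0 ≤ q := hmax (by simpa only [Set.mem_ofPred_eq, toBidual_zero, bidualLE_zero_sub])
  have hs : IsSingular (toBidual c - h - toBidual q) := by
    refine ⟨bidualLE_zero_sub.2 hq, fun f hf hfq => le_antisymm ?_ hf⟩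
    rw [bidualLE_sub_iff, ← toBidual_add] at hfq
    exact nonpos_of_add_le_left (hmax hfq)
  refine ⟨c - q, 0 - (toBidual c - h - toBidual q), sub_le_self c hq0, ?_, ?_,
    isPurelySingular_iff.2 ⟨0, _, isSingular_zero, hs, rfl⟩⟩
  · exact fun ℓ hℓ => (zero_sub _).trans_le (neg_nonpos.2 (hs.1 ℓ hℓ))
  · rw [toBidual_sub]
    abel

theorem existsUnique_isRegularSingular_of_le {c : Lp ℝ 1 π} (hc : BidualLE h (toBidual c)) :
    ∃! p : Lp ℝ 1 π × Bidual (Lp ℝ 1 π), IsRegularSingular h p.1 p.2 := by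
  obtain ⟨r, s, -, -, hrs⟩ := exists_isRegularSingular_of_le hc
  exact ⟨(r, s), hrs, fun p hp => Prod.ext (hp.unique hrs).1 (hp.unique hrs).2⟩

theorem IsRegularSingular.le_and_bidualLE_zero {c r : Lp ℝ 1 π} {s : Bidual (Lp ℝ 1 π)}
    (H : IsRegularSingular h r s) (hc : BidualLE h (toBidual c)) : r ≤ c ∧ BidualLE s 0 := by
  obtain ⟨r', s', hr', hs', H'⟩ := exists_isRegularSingular_of_le hc
  obtain ⟨rfl, rfl⟩ := H.unique H'
  exact ⟨hr', hs'⟩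

end Decomposition

section Plans

theorem PlanLE.lintegral_ne_top {Z : Type*} [MeasurableSpace Z] {π ρ : Measure Z}
    [IsFiniteMeasure ρ] [IsFiniteMeasure π] (h : PlanLE ρ π) {c : Z → ℝ≥0∞}
    (hπ : ∫⁻ z, c z ∂π ≠ ∞) : ∫⁻ z, c z ∂ρ ≠ ∞ := by
  refine ne_top_of_le_ne_top ?_ (lintegral_mono' h.le_smul le_rfl)
  rw [lintegral_smul_measure, smul_eq_mul]
  exact ENNReal.mul_ne_top h.2.ne hπ

theorem integralDual_costL1 {Z : Type*} [MeasurableSpace Z] {π ρ : Measure Z}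
    [IsFiniteMeasure ρ] [IsFiniteMeasure π] (h : PlanLE ρ π) {c : Z → ℝ≥0∞} (hc : Measurable c)
    (hπ : ∫⁻ z, c z ∂π ≠ ∞) : integralDual h (costL1 c hc hπ) = (∫⁻ z, c z ∂ρ).toReal := by
  rw [integralDual_apply, costL1, integral_congr_ae (h.1.ae_eq (Integrable.coeFn_toL1 _)),
    integral_toReal hc.aemeasurable (ae_lt_top hc (h.lintegral_ne_top hπ))]

theorem map_inv_smul_eq {Z W : Type*} [MeasurableSpace Z] [MeasurableSpace W] {ρ : Measure Z}
    [IsFiniteMeasure ρ] [NeZero ρ] {κ : Measure W} [IsFiniteMeasure κ] {f : Z → W}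
    (hf : Measurable f)
    (h : ∀ A, MeasurableSet A → ρ.real (f ⁻¹' A) = ρ.real Set.univ * κ.real A) :
    ((ρ Set.univ)⁻¹ • ρ).map f = κ := by
  ext A hA
  have hA' : ρ (f ⁻¹' A) = ρ Set.univ * κ A := by
    rw [← ENNReal.toReal_eq_toReal_iff' (measure_ne_top _ _)
      (ENNReal.mul_ne_top (measure_ne_top _ _) (measure_ne_top _ _)), ENNReal.toReal_mul]
    exact h A hA
  rw [Measure.map_apply hf hA, Measure.smul_apply, hA', smul_eq_mul, ← mul_assoc,
    ENNReal.inv_mul_cancel (NeZero.ne _) (measure_ne_top _ _), one_mul]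

theorem inv_two_smul_add_self {Z : Type*} [MeasurableSpace Z] (κ : Measure Z) :
    (2 : ℝ≥0∞)⁻¹ • (κ + κ) = κ := by
  rw [smul_add, ← add_smul, ENNReal.inv_two_add_inv_two, one_smul]

variable {X Y : Type*} [MeasurableSpace X] [MeasurableSpace Y] {μ : Measure X} {ν : Measure Y}
  {π ρ π₁ π₂ : Measure (X × Y)} {c : X × Y → ℝ≥0∞}

theorem measurePreserving_fst (hπ : π ∈ plans μ ν) : MeasurePreserving Prod.fst π μ :=
  ⟨measurable_fst, hπ.1⟩

theorem measurePreserving_snd (hπ : π ∈ plans μ ν) : MeasurePreserving Prod.snd π ν :=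
  ⟨measurable_snd, hπ.2⟩

theorem isProbabilityMeasure_of_mem_plans [IsProbabilityMeasure μ] (hπ : π ∈ plans μ ν) :
    IsProbabilityMeasure π :=
  ⟨by rw [← Measure.fst_univ, hπ.1, measure_univ]⟩

theorem isProbabilityMeasure_snd_of_mem_plans [IsProbabilityMeasure μ] (hπ : π ∈ plans μ ν) :
    IsProbabilityMeasure ν :=
  have := isProbabilityMeasure_of_mem_plans hπ
  hπ.2 ▸ inferInstanceAs (IsProbabilityMeasure π.snd)

theorem integrable_fst (hπ : π ∈ plans μ ν) {φ : X → ℝ} (hφ : Integrable φ μ) :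
    Integrable (fun z : X × Y => φ z.1) π :=
  (measurePreserving_fst hπ).integrable_comp_of_integrable hφ

theorem integrable_snd (hπ : π ∈ plans μ ν) {ψ : Y → ℝ} (hψ : Integrable ψ ν) :
    Integrable (fun z : X × Y => ψ z.2) π :=
  (measurePreserving_snd hπ).integrable_comp_of_integrable hψ

theorem integrable_oplus (hπ : π ∈ plans μ ν) {φ : X → ℝ} {ψ : Y → ℝ} (hφ : Integrable φ μ)
    (hψ : Integrable ψ ν) : Integrable (fun z : X × Y => φ z.1 + ψ z.2) π :=
  (integrable_fst hπ hφ).add (integrable_snd hπ hψ)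

theorem integral_oplus (hπ : π ∈ plans μ ν) {φ : X → ℝ} {ψ : Y → ℝ} (hφ : Integrable φ μ)
    (hψ : Integrable ψ ν) : ∫ z, (φ z.1 + ψ z.2) ∂π = ∫ x, φ x ∂μ + ∫ y, ψ y ∂ν := by
  have hfst : ∫ x, φ x ∂μ = ∫ z, φ z.1 ∂π := by
    have hmap := (measurePreserving_fst hπ).map_eq
    rw [← hmap]
    exact integral_map measurable_fst.aemeasurable (hmap ▸ hφ.aestronglyMeasurable)
  have hsnd : ∫ y, ψ y ∂ν = ∫ z, ψ z.2 ∂π := by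
    have hmap := (measurePreserving_snd hπ).map_eq
    rw [← hmap]
    exact integral_map measurable_snd.aemeasurable (hmap ▸ hψ.aestronglyMeasurable)
  rw [integral_add (integrable_fst hπ hφ) (integrable_snd hπ hψ), hfst, hsnd]

theorem inv_two_smul_add_mem_plans (h₁ : π₁ ∈ plans μ ν) (h₂ : π₂ ∈ plans μ ν) :
    (2 : ℝ≥0∞)⁻¹ • (π₁ + π₂) ∈ plans μ ν := by
  constructor
  · rw [Measure.fst, Measure.map_smul, Measure.map_add _ _ measurable_fst,
      (measurePreserving_fst h₁).map_eq, (measurePreserving_fst h₂).map_eq, inv_two_smul_add_self]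
  · rw [Measure.snd, Measure.map_smul, Measure.map_add _ _ measurable_snd,
      (measurePreserving_snd h₁).map_eq, (measurePreserving_snd h₂).map_eq, inv_two_smul_add_self]

theorem inv_smul_mem_plans [IsFiniteMeasure μ] [IsFiniteMeasure ν] [IsFiniteMeasure ρ] [NeZero ρ]
    (hρ : ∀ (φ : X → ℝ) (ψ : Y → ℝ), Integrable φ μ → Integrable ψ ν →
      ∫ z, (φ z.1 + ψ z.2) ∂ρ = ρ.real Set.univ * (∫ x, φ x ∂μ + ∫ y, ψ y ∂ν)) :
    (ρ Set.univ)⁻¹ • ρ ∈ plans μ ν := by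
  refine ⟨map_inv_smul_eq measurable_fst fun A hA => ?_,
    map_inv_smul_eq measurable_snd fun B hB => ?_⟩
  · have h := hρ (A.indicator 1) 0 ((integrable_const _).indicator hA) (integrable_zero _ _ _)
    simp only [Pi.zero_apply, add_zero, integral_zero, integral_indicator_one hA] at h
    exact (integral_indicator_one (measurable_fst hA)).symm.trans h
  · have h := hρ 0 (B.indicator 1) (integrable_zero _ _ _) ((integrable_const _).indicator hB)
    simp only [Pi.zero_apply, zero_add, integral_zero, integral_indicator_one hB] at h
    exact (integral_indicator_one (measurable_snd hB)).symm.trans h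

theorem mul_le_integralDual_costL1 [IsFiniteMeasure μ] [IsFiniteMeasure ν]
    [IsFiniteMeasure ρ] [IsFiniteMeasure π] (hc : Measurable c) (hπ : ∫⁻ z, c z ∂π ≠ ∞) {p : ℝ}
    (hp : ENNReal.ofReal p ≤ primalAt μ ν c π) (h : PlanLE ρ π)
    (hρ : ∀ (φ : X → ℝ) (ψ : Y → ℝ), Integrable φ μ → Integrable ψ ν →
      ∫ z, (φ z.1 + ψ z.2) ∂ρ = ρ.real Set.univ * (∫ x, φ x ∂μ + ∫ y, ψ y ∂ν)) :
    p * ρ.real Set.univ ≤ integralDual h (costL1 c hc hπ) := by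
  have hle : ENNReal.ofReal p * ρ Set.univ ≤ ∫⁻ z, c z ∂ρ := by
    rcases eq_zero_or_neZero ρ with rfl | _
    · simp
    have hinv : (ρ Set.univ)⁻¹ ≠ ∞ := ENNReal.inv_ne_top.2 (NeZero.ne _)
    have : IsFiniteMeasure ((ρ Set.univ)⁻¹ • ρ) := Measure.smul_finite ρ hinv
    have hcost := hp.trans (iInf₂_le ((ρ Set.univ)⁻¹ • ρ)
      ⟨inv_smul_mem_plans hρ, (PlanLE.of_le_smul hinv le_rfl).trans h⟩)
    rwa [lintegral_smul_measure, smul_eq_mul, mul_comm, ← div_eq_mul_inv,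
      ENNReal.le_div_iff_mul_le (.inl (NeZero.ne _)) (.inl (measure_ne_top _ _))] at hcost
  rw [integralDual_costL1]
  calc p * ρ.real Set.univ ≤ (ENNReal.ofReal p * ρ Set.univ).toReal := by
        rw [ENNReal.toReal_mul, ENNReal.toReal_ofReal']
        exact mul_le_mul_of_nonneg_right (le_max_left _ _) measureReal_nonneg
    _ ≤ (∫⁻ z, c z ∂ρ).toReal := ENNReal.toReal_mono (h.lintegral_ne_top hπ) hle

end Plans

section BidualOfPositive

variable {Z : Type*} [MeasurableSpace Z] {π : Measure Z}

theorem isNonneg_norm_smul_integralCLM_add (ℓ : StrongDual ℝ (Lp ℝ 1 π)) :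
    IsNonneg (‖ℓ‖ • (L1.integralCLM : StrongDual ℝ (Lp ℝ 1 π)) + ℓ) := fun f hf => by
  rw [add_apply, smul_apply, integralCLM_apply, ← norm_eq_integral_of_nonneg hf, smul_eq_mul]
  linarith [(abs_le.1 (ℓ.le_opNorm f)).1]

theorem exists_bidual_of_nonneg (T : StrongDual ℝ (Lp ℝ 1 π) →ₗ[ℝ] ℝ)
    (hT : ∀ ℓ, IsNonneg ℓ → 0 ≤ T ℓ) : ∃ k : Bidual (Lp ℝ 1 π), ∀ ℓ, k ℓ = T ℓ := by
  refine ⟨T.mkContinuous (T L1.integralCLM) fun ℓ => ?_, fun _ => rfl⟩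
  have hadd := hT _ (isNonneg_norm_smul_integralCLM_add ℓ)
  have hsub := hT _ (isNonneg_norm_smul_integralCLM_add (-ℓ))
  rw [map_add, map_smul, smul_eq_mul] at hadd hsub
  rw [map_neg, norm_neg] at hsub
  rw [Real.norm_eq_abs, abs_le]
  constructor <;> linarith

end BidualOfPositive

section Family

variable {X Y : Type*} [MeasurableSpace X] [MeasurableSpace Y] {μ : Measure X} {ν : Measure Y}
  {c : X × Y → ℝ≥0∞} {π₀ : Measure (X × Y)}

theorem PlanLE.exists_planLE_planLE [IsProbabilityMeasure μ] [IsFiniteMeasure π₀]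
    (π₁ π₂ : PlansAbove μ ν c π₀) :
    ∃ π₃ : PlansAbove μ ν c π₀, PlanLE π₁.1 π₃.1 ∧ PlanLE π₂.1 π₃.1 := by
  have hmem := inv_two_smul_add_mem_plans π₁.2.1.1 π₂.2.1.1
  have := isProbabilityMeasure_of_mem_plans hmem
  have htwo : (2 : ℝ≥0∞) • (2 : ℝ≥0∞)⁻¹ • (π₁.1 + π₂.1) = π₁.1 + π₂.1 := by
    rw [← mul_smul, ENNReal.mul_inv_cancel two_ne_zero ENNReal.ofNat_ne_top, one_smul]
  have h₁ : PlanLE π₁.1 ((2 : ℝ≥0∞)⁻¹ • (π₁.1 + π₂.1)) :=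
    .of_le_smul ENNReal.ofNat_ne_top ((Measure.le_add_right le_rfl).trans_eq htwo.symm)
  have h₂ : PlanLE π₂.1 ((2 : ℝ≥0∞)⁻¹ • (π₁.1 + π₂.1)) :=
    .of_le_smul ENNReal.ofNat_ne_top ((Measure.le_add_left le_rfl).trans_eq htwo.symm)
  have hcost : ∫⁻ z, c z ∂((2 : ℝ≥0∞)⁻¹ • (π₁.1 + π₂.1)) ≠ ∞ := by
    rw [lintegral_smul_measure, lintegral_add_measure]
    exact ENNReal.mul_ne_top (by simp) (ENNReal.add_ne_top.2 ⟨π₁.2.1.2, π₂.2.1.2⟩)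
  exact ⟨⟨_, ⟨hmem, hcost⟩, π₁.2.2.trans h₁⟩, h₁, h₂⟩

variable (μ ν c π₀) in
/-- The functions which are integrable for all plans above `π₀`. The duals of the spaces `L¹(π)` are
compared through their action on these functions. -/
def commonIntegrable : Submodule ℝ (X × Y → ℝ) where
  carrier := {f | ∀ π : PlansAbove μ ν c π₀, Integrable f π.1}
  add_mem' hf hg π := (hf π).add (hg π)
  zero_mem' _ := integrable_zero _ _ _
  smul_mem' a _ hf π := (hf π).smul a

/-- The class in `L¹(π)` of a function integrable for all plans above `π₀`. -/
def commonToL1 (π : PlansAbove μ ν c π₀) : commonIntegrable μ ν c π₀ →ₗ[ℝ] Lp ℝ 1 π.1 where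
  toFun f := (f.2 π).toL1 f.1
  map_add' f g := Integrable.toL1_add _ _ (f.2 π) (g.2 π)
  map_smul' a f := Integrable.toL1_smul _ (f.2 π) a

theorem coeFn_commonToL1 (π : PlansAbove μ ν c π₀) (f : commonIntegrable μ ν c π₀) :
    commonToL1 π f =ᵐ[π.1] f.1 := (f.2 π).coeFn_toL1

/-- The functional on the common integrable functions induced by a functional on `L¹(π)`. -/
def restrictDual (π : PlansAbove μ ν c π₀) :
    StrongDual ℝ (Lp ℝ 1 π.1) →ₗ[ℝ] commonIntegrable μ ν c π₀ →ₗ[ℝ] ℝ :=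
  (commonToL1 π).lcomp ℝ ℝ ∘ₗ ContinuousLinearMap.coeLM ℝ

theorem restrictDual_apply (π : PlansAbove μ ν c π₀) (ℓ : StrongDual ℝ (Lp ℝ 1 π.1))
    (f : commonIntegrable μ ν c π₀) : restrictDual π ℓ f = ℓ (commonToL1 π f) := rfl

/-- The function `φ ⊕ ψ` as a common integrable function. -/
def commonOplus {φ : X → ℝ} {ψ : Y → ℝ} (hφ : Integrable φ μ) (hψ : Integrable ψ ν) :
    commonIntegrable μ ν c π₀ :=
  ⟨fun z => φ z.1 + ψ z.2, fun π => integrable_oplus π.2.1.1 hφ hψ⟩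

theorem mem_L1S_commonToL1_commonOplus (π : PlansAbove μ ν c π₀) {φ : X → ℝ} {ψ : Y → ℝ}
    (hφ : Integrable φ μ) (hψ : Integrable ψ ν) :
    commonToL1 π (commonOplus hφ hψ) ∈ L1S μ ν π.1 :=
  Submodule.le_topologicalClosure _ (Submodule.subset_span
    ⟨φ, ψ, hφ, hψ, coeFn_commonToL1 π (commonOplus hφ hψ)⟩)

/-- The cost as a common integrable function. -/
def commonCost (hc : Measurable c) : commonIntegrable μ ν c π₀ :=
  ⟨fun z => (c z).toReal, fun π => integrable_toReal_of_lintegral_ne_top hc.aemeasurable π.2.1.2⟩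

theorem commonToL1_commonCost (hc : Measurable c) (π : PlansAbove μ ν c π₀) :
    commonToL1 π (commonCost hc) = costL1 c hc π.2.1.2 := rfl

variable (μ ν c π₀) in
/-- The union of the duals of the spaces `L¹(π)` over the plans `π` above `π₀`. -/
def dualUnion : Submodule ℝ (commonIntegrable μ ν c π₀ →ₗ[ℝ] ℝ) :=
  ⨆ π, LinearMap.range (restrictDual π)

/-- The embedding of `L¹(π)*` into the union of the duals. -/
def toDualUnion (π : PlansAbove μ ν c π₀) :
    StrongDual ℝ (Lp ℝ 1 π.1) →ₗ[ℝ] dualUnion μ ν c π₀ :=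
  (restrictDual π).codRestrict _ fun ℓ => Submodule.mem_iSup_of_mem π ⟨ℓ, rfl⟩

variable [IsProbabilityMeasure μ]

/-- The constant `1` as a common integrable function. -/
def commonOne : commonIntegrable μ ν c π₀ :=
  ⟨fun _ => 1, fun _ => integrable_const 1⟩

theorem integralDual_commonToL1 {π : PlansAbove μ ν c π₀} {ρ : Measure (X × Y)}
    [IsFiniteMeasure ρ] (h : PlanLE ρ π.1) (f : commonIntegrable μ ν c π₀) :
    integralDual h (commonToL1 π f) = ∫ z, f.1 z ∂ρ :=
  (integralDual_apply h _).trans (integral_congr_ae (h.1.ae_eq (coeFn_commonToL1 π f)))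

theorem integralDual_commonOne {π : PlansAbove μ ν c π₀} {ρ : Measure (X × Y)}
    [IsFiniteMeasure ρ] (h : PlanLE ρ π.1) :
    integralDual h (commonToL1 π commonOne) = ρ.real Set.univ := by
  rw [integralDual_commonToL1, commonOne, integral_const, smul_eq_mul, mul_one]

theorem proj_commonToL1 {π₁ π₂ : PlansAbove μ ν c π₀} (h : PlanLE π₁.1 π₂.1)
    (f : commonIntegrable μ ν c π₀) : proj h (commonToL1 π₂ f) = commonToL1 π₁ f :=
  Lp.ext <| (h.memLp _).coeFn_toLp.trans <|
    (h.1.ae_eq (coeFn_commonToL1 π₂ f)).trans (coeFn_commonToL1 π₁ f).symm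

theorem restrictDual_comp_proj {π₁ π₂ : PlansAbove μ ν c π₀} (h : PlanLE π₁.1 π₂.1)
    (ℓ : StrongDual ℝ (Lp ℝ 1 π₁.1)) :
    restrictDual π₂ (ℓ.comp (proj h)) = restrictDual π₁ ℓ :=
  LinearMap.ext fun f => congrArg ℓ (proj_commonToL1 h f)

theorem mem_dualUnion_iff (hπ₀ : π₀ ∈ finitePlans μ ν c)
    {m : commonIntegrable μ ν c π₀ →ₗ[ℝ] ℝ} :
    m ∈ dualUnion μ ν c π₀ ↔ ∃ π ℓ, restrictDual π ℓ = m := by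
  have := isProbabilityMeasure_of_mem_plans hπ₀.1
  have : Nonempty (PlansAbove μ ν c π₀) := ⟨⟨π₀, hπ₀, .refl⟩⟩
  refine Submodule.mem_iSup_of_directed _ fun π₁ π₂ => ?_
  obtain ⟨π₃, h₁, h₂⟩ := PlanLE.exists_planLE_planLE π₁ π₂
  refine ⟨π₃, ?_, ?_⟩
  · rintro _ ⟨ℓ, rfl⟩
    exact ⟨ℓ.comp (proj h₁), restrictDual_comp_proj h₁ ℓ⟩
  · rintro _ ⟨ℓ, rfl⟩
    exact ⟨ℓ.comp (proj h₂), restrictDual_comp_proj h₂ ℓ⟩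

theorem toDualUnion_comp_proj {π₁ π₂ : PlansAbove μ ν c π₀} (h : PlanLE π₁.1 π₂.1)
    (ℓ : StrongDual ℝ (Lp ℝ 1 π₁.1)) :
    toDualUnion π₂ (ℓ.comp (proj h)) = toDualUnion π₁ ℓ :=
  Subtype.ext (restrictDual_comp_proj h ℓ)

theorem IsNonneg.comp_proj {Z : Type*} [MeasurableSpace Z] {π₁ π₂ : Measure Z}
    [IsFiniteMeasure π₁] [IsFiniteMeasure π₂] {ℓ : StrongDual ℝ (Lp ℝ 1 π₁)} (hℓ : IsNonneg ℓ)
    (h : PlanLE π₁ π₂) : IsNonneg (ℓ.comp (proj h)) := by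
  obtain ⟨ρ, _, hρ, rfl⟩ := hℓ.exists_eq_integralDual
  rw [integralDual_comp_proj]
  exact isNonneg_integralDual _

/-- The positive cone of the union of the duals. -/
def dualCone (hπ₀ : π₀ ∈ finitePlans μ ν c) : PointedCone ℝ (dualUnion μ ν c π₀) where
  carrier := {m | ∃ π ℓ, IsNonneg ℓ ∧ toDualUnion π ℓ = m}
  add_mem' := by
    rintro _ _ ⟨π₁, ℓ₁, hℓ₁, rfl⟩ ⟨π₂, ℓ₂, hℓ₂, rfl⟩
    have := isProbabilityMeasure_of_mem_plans hπ₀.1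
    obtain ⟨π₃, h₁, h₂⟩ := PlanLE.exists_planLE_planLE π₁ π₂
    refine ⟨π₃, ℓ₁.comp (proj h₁) + ℓ₂.comp (proj h₂), fun f hf =>
      add_nonneg (hℓ₁.comp_proj h₁ f hf) (hℓ₂.comp_proj h₂ f hf), ?_⟩
    rw [map_add, toDualUnion_comp_proj, toDualUnion_comp_proj]
  zero_mem' := by
    have := isProbabilityMeasure_of_mem_plans hπ₀.1
    exact ⟨⟨π₀, hπ₀, .refl⟩, 0, fun _ _ => le_rfl, map_zero _⟩
  smul_mem' := by
    rintro a _ ⟨π, ℓ, hℓ, rfl⟩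
    exact ⟨π, (a : ℝ) • ℓ, fun f hf => mul_nonneg a.2 (hℓ f hf), map_smul _ _ _⟩

variable (μ ν c π₀) in
/-- The functionals which act on the functions `φ ⊕ ψ` as a multiple of a transport plan does. -/
def planMultiples : Submodule ℝ (commonIntegrable μ ν c π₀ →ₗ[ℝ] ℝ) where
  carrier := {m | ∀ (φ : X → ℝ) (ψ : Y → ℝ) (hφ : Integrable φ μ) (hψ : Integrable ψ ν),
    m (commonOplus hφ hψ) = m commonOne * (∫ x, φ x ∂μ + ∫ y, ψ y ∂ν)}
  add_mem' h h' _ _ _ _ := by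
    rw [LinearMap.add_apply, LinearMap.add_apply, h, h', add_mul]
  zero_mem' _ _ _ _ := (zero_mul _).symm
  smul_mem' _ _ h _ _ _ _ := by
    rw [LinearMap.smul_apply, LinearMap.smul_apply, h, smul_eq_mul, smul_eq_mul, mul_assoc]

theorem restrictDual_integralDual_mem_planMultiples_iff {π : PlansAbove μ ν c π₀}
    {ρ : Measure (X × Y)} [IsFiniteMeasure ρ] (h : PlanLE ρ π.1) :
    restrictDual π (integralDual h) ∈ planMultiples μ ν c π₀ ↔
      ∀ (φ : X → ℝ) (ψ : Y → ℝ), Integrable φ μ → Integrable ψ ν →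
        ∫ z, (φ z.1 + ψ z.2) ∂ρ = ρ.real Set.univ * (∫ x, φ x ∂μ + ∫ y, ψ y ∂ν) := by
  refine forall₄_congr fun φ ψ hφ hψ => ?_
  rw [restrictDual_apply, restrictDual_apply, integralDual_commonOne, integralDual_commonToL1]
  rfl

theorem restrictDual_integralCLM_mem_planMultiples (π : PlansAbove μ ν c π₀) :
    restrictDual π L1.integralCLM ∈ planMultiples μ ν c π₀ := by
  rw [← integralDual_refl, restrictDual_integralDual_mem_planMultiples_iff]
  intro φ ψ hφ hψ
  rw [integral_oplus π.2.1.1 hφ hψ, probReal_univ, one_mul]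

theorem mul_restrictDual_commonOne_le (hc : Measurable c) {p : ℝ} {π : PlansAbove μ ν c π₀}
    (hp : ENNReal.ofReal p ≤ primalAt μ ν c π.1) {ℓ : StrongDual ℝ (Lp ℝ 1 π.1)}
    (hℓ : IsNonneg ℓ) (hmem : restrictDual π ℓ ∈ planMultiples μ ν c π₀) :
    p * restrictDual π ℓ commonOne ≤ restrictDual π ℓ (commonCost hc) := by
  have := isProbabilityMeasure_snd_of_mem_plans π.2.1.1
  obtain ⟨ρ, _, hρ, rfl⟩ := hℓ.exists_eq_integralDual
  rw [restrictDual_apply, restrictDual_apply, integralDual_commonOne, commonToL1_commonCost]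
  exact mul_le_integralDual_costL1 hc π.2.1.2 hp hρ
    ((restrictDual_integralDual_mem_planMultiples_iff hρ).1 hmem)

/- M. Riesz' extension theorem applied to `m ↦ m c - p m(1)`: positive multiples of plans cost at
least `p` times their mass, and multiples of plans dominate every functional. -/
theorem exists_nonneg_extension (hc : Measurable c) (hπ₀ : π₀ ∈ finitePlans μ ν c) {p : ℝ}
    (hp : ∀ π : PlansAbove μ ν c π₀, ENNReal.ofReal p ≤ primalAt μ ν c π.1) :
    ∃ G : dualUnion μ ν c π₀ →ₗ[ℝ] ℝ,
      (∀ m : dualUnion μ ν c π₀, m.1 ∈ planMultiples μ ν c π₀ →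
        G m = m.1 (commonCost hc) - p * m.1 commonOne) ∧
      ∀ m ∈ dualCone hπ₀, 0 ≤ G m := by
  let G₀ : (commonIntegrable μ ν c π₀ →ₗ[ℝ] ℝ) →ₗ[ℝ] ℝ :=
    LinearMap.applyₗ (commonCost hc) - p • LinearMap.applyₗ commonOne
  let T : dualUnion μ ν c π₀ →ₗ.[ℝ] ℝ :=
    { domain := (planMultiples μ ν c π₀).comap (dualUnion μ ν c π₀).subtype
      toFun := G₀ ∘ₗ Submodule.subtype _ ∘ₗ Submodule.subtype _ }
  have hnonneg : ∀ x : T.domain, (x : dualUnion μ ν c π₀) ∈ dualCone hπ₀ → 0 ≤ T x := by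
    rintro ⟨_, hm⟩ ⟨π, ℓ, hℓ, rfl⟩
    exact sub_nonneg.2 (mul_restrictDual_commonOne_le hc (hp π) hℓ hm)
  have hdense : ∀ y, ∃ x : T.domain, (x : dualUnion μ ν c π₀) + y ∈ dualCone hπ₀ := by
    rintro ⟨m, hm⟩
    obtain ⟨π, ℓ, rfl⟩ := (mem_dualUnion_iff hπ₀).1 hm
    exact ⟨⟨toDualUnion π (‖ℓ‖ • L1.integralCLM), Submodule.smul_mem _ _
      (restrictDual_integralCLM_mem_planMultiples π)⟩, π, ‖ℓ‖ • L1.integralCLM + ℓ,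
      isNonneg_norm_smul_integralCLM_add ℓ, map_add _ _ _⟩
  obtain ⟨G, hG, hG0⟩ := riesz_extension (dualCone hπ₀) T hnonneg hdense
  exact ⟨G, fun m hm => hG ⟨m, hm⟩, hG0⟩

theorem restrictDual_commonOne_eq_zero {π : PlansAbove μ ν c π₀}
    {ℓ : StrongDual ℝ (Lp ℝ 1 π.1)} (hℓ : ∀ f ∈ L1S μ ν π.1, ℓ f = 0) :
    restrictDual π ℓ commonOne = 0 := by
  have hone : (commonOne : commonIntegrable μ ν c π₀) =
      commonOplus (integrable_const (1 : ℝ)) (integrable_zero Y ℝ ν) :=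
    Subtype.ext (funext fun _ => (add_zero (1 : ℝ)).symm)
  rw [hone]
  exact hℓ _ (mem_L1S_commonToL1_commonOplus π _ _)

theorem restrictDual_mem_planMultiples {π : PlansAbove μ ν c π₀}
    {ℓ : StrongDual ℝ (Lp ℝ 1 π.1)} (hℓ : ∀ f ∈ L1S μ ν π.1, ℓ f = 0) :
    restrictDual π ℓ ∈ planMultiples μ ν c π₀ := fun φ ψ hφ hψ => by
  rw [restrictDual_commonOne_eq_zero hℓ, zero_mul]
  exact hℓ _ (mem_L1S_commonToL1_commonOplus π hφ hψ)

theorem exists_projectiveFamily_nonneg (hc : Measurable c) (hπ₀ : π₀ ∈ finitePlans μ ν c) {p : ℝ}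
    (hp : ∀ π : PlansAbove μ ν c π₀, ENNReal.ofReal p ≤ primalAt μ ν c π.1) :
    ∃ K : ∀ π : PlansAbove μ ν c π₀, Bidual (Lp ℝ 1 π.1), IsProjectiveFamily K ∧
      ∀ π, BidualLE 0 (K π) ∧ ∀ ℓ, restrictDual π ℓ ∈ planMultiples μ ν c π₀ →
        K π ℓ = ℓ (costL1 c hc π.2.1.2) - p * restrictDual π ℓ commonOne := by
  obtain ⟨G, hG, hG0⟩ := exists_nonneg_extension hc hπ₀ hp
  have hnonneg (π : PlansAbove μ ν c π₀) (ℓ : StrongDual ℝ (Lp ℝ 1 π.1)) (hℓ : IsNonneg ℓ) :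
      0 ≤ (G ∘ₗ toDualUnion π) ℓ := hG0 _ ⟨π, ℓ, hℓ, rfl⟩
  choose K hK using fun π => exists_bidual_of_nonneg _ (hnonneg π)
  refine ⟨K, fun π₁ π₂ h => ContinuousLinearMap.ext fun ℓ => ?_, fun π => ⟨fun ℓ hℓ => ?_,
    fun ℓ hℓ => (hK π ℓ).trans (hG _ hℓ)⟩⟩
  · change K π₂ (ℓ.comp (proj h)) = K π₁ ℓ
    rw [hK, hK, LinearMap.comp_apply, LinearMap.comp_apply, toDualUnion_comp_proj]
  · rw [hK]
    exact hnonneg π ℓ hℓ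

theorem exists_projectiveFamily (hc : Measurable c) (hπ₀ : π₀ ∈ finitePlans μ ν c) {p : ℝ}
    (hp : ∀ π : PlansAbove μ ν c π₀, ENNReal.ofReal p ≤ primalAt μ ν c π.1) :
    ∃ H : ∀ π : PlansAbove μ ν c π₀, Bidual (Lp ℝ 1 π.1), IsProjectiveFamily H ∧
      ∀ π : PlansAbove μ ν c π₀,
        (∀ ℓ : StrongDual ℝ (Lp ℝ 1 π.1), (∀ f ∈ L1S μ ν π.1, ℓ f = 0) → H π ℓ = 0) ∧
        BidualLE (H π) (toBidual (costL1 c hc π.2.1.2)) ∧ pairing (H π) = p := by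
  obtain ⟨K, hproj, hK⟩ := exists_projectiveFamily_nonneg hc hπ₀ hp
  refine ⟨fun π => toBidual (costL1 c hc π.2.1.2) - K π, fun π₁ π₂ h => ?_, fun π => ⟨?_, ?_, ?_⟩⟩
  · refine ContinuousLinearMap.ext fun ℓ => ?_
    change ℓ (proj h (costL1 c hc π₂.2.1.2)) - bidualMap (proj h) (K π₂) ℓ =
      ℓ (costL1 c hc π₁.2.1.2) - K π₁ ℓ
    rw [hproj, ← commonToL1_commonCost, ← commonToL1_commonCost, proj_commonToL1]
  · intro ℓ hℓ
    change ℓ (costL1 c hc π.2.1.2) - K π ℓ = 0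
    rw [(hK π).2 ℓ (restrictDual_mem_planMultiples hℓ), restrictDual_commonOne_eq_zero hℓ,
      mul_zero, sub_zero, sub_self]
  · exact fun ℓ hℓ => sub_le_self _ ((hK π).1 ℓ hℓ)
  · have hone : restrictDual π L1.integralCLM commonOne = 1 := by
      rw [← integralDual_refl, restrictDual_apply, integralDual_commonOne, probReal_univ]
    change L1.integralCLM (costL1 c hc π.2.1.2) - K π L1.integralCLM = p
    rw [(hK π).2 _ (restrictDual_integralCLM_mem_planMultiples π), hone]
    ring

end Family

section Annihilator

theorem mem_range_bidualMap_subtypeL_iff {E : Type*} [NormedAddCommGroup E] [NormedSpace ℝ E]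
    (M : Submodule ℝ E) {h : Bidual E} :
    h ∈ Set.range (bidualMap M.subtypeL) ↔
      ∀ ℓ : StrongDual ℝ E, (∀ f ∈ M, ℓ f = 0) → h ℓ = 0 := by
  constructor
  · rintro ⟨g, rfl⟩ ℓ hℓ
    have hrestrict : ℓ.comp M.subtypeL = 0 := ContinuousLinearMap.ext fun f => hℓ f f.2
    exact (congrArg g hrestrict).trans (map_zero g)
  · intro hM
    let R : StrongDual ℝ E →L[ℝ] StrongDual ℝ M := ContinuousLinearMap.precomp ℝ M.subtypeL
    have hR : Function.Surjective R := fun k =>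
      (exists_extension_norm_eq M k).imp fun ℓ hℓ => ContinuousLinearMap.ext hℓ.1
    obtain ⟨s, hs⟩ := R.toLinearMap.exists_rightInverse_of_surjective (LinearMap.range_eq_top.2 hR)
    have hfactor (ℓ : StrongDual ℝ E) : h (s (R ℓ)) = h ℓ := by
      refine sub_eq_zero.1 ((map_sub h _ _).symm.trans (hM _ fun f hf => sub_eq_zero.2 ?_))
      exact DFunLike.congr_fun (DFunLike.congr_fun hs (R ℓ)) (⟨f, hf⟩ : M)
    have hquot : IsQuotientMap R :=
      ContinuousLinearMap.isQuotientMap (𝕜 := ℝ) (𝕜' := ℝ) (F := StrongDual ℝ M) R hR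
    have hcont : Continuous fun k => h (s k) :=
      hquot.continuous_iff.2 (h.continuous.congr fun ℓ => (hfactor ℓ).symm)
    exact ⟨⟨h.toLinearMap ∘ₗ s, hcont⟩, ContinuousLinearMap.ext hfactor⟩

end Annihilator

section Helly

theorem nonpos_of_forall_add_mul_le {a b u : ℝ} (h : ∀ t, 0 ≤ t → a + t * b ≤ u) : b ≤ 0 := by
  by_contra! hb
  have hau : a ≤ u := by linarith [h 0 le_rfl]
  have ht := h ((u - a) / b + 1) (by positivity [sub_nonneg.2 hau])
  rw [add_mul, div_mul_cancel₀ _ hb.ne'] at ht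
  linarith

variable {E : Type*} [NormedAddCommGroup E] [NormedSpace ℝ E] {M : Submodule ℝ E}

theorem exists_apply_eq_mul_of_ker_le {I ℓ : StrongDual ℝ E} (h : ∀ f ∈ M, I f = 0 → ℓ f = 0) :
    ∃ a, ∀ f ∈ M, ℓ f = a * I f := by
  by_cases hI : ∃ e ∈ M, I e ≠ 0
  · obtain ⟨e, he, hIe⟩ := hI
    refine ⟨ℓ e / I e, fun f hf => ?_⟩
    have hker := h (I e • f - I f • e) (M.sub_mem (M.smul_mem _ hf) (M.smul_mem _ he))
    simp only [map_sub, map_smul, smul_eq_mul] at hker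
    field_simp
    linarith [hker (by ring)]
  · push Not at hI
    exact ⟨0, fun f hf => by rw [zero_mul, h f hf (hI f hf)]⟩

theorem exists_mem_apply_eq {h : Bidual E}
    (hM : ∀ ℓ : StrongDual ℝ E, (∀ f ∈ M, ℓ f = 0) → h ℓ = 0) (I : StrongDual ℝ E) :
    ∃ f ∈ M, I f = h I := by
  by_cases hI : ∃ e ∈ M, I e ≠ 0
  · obtain ⟨e, he, hIe⟩ := hI
    exact ⟨(h I / I e) • e, M.smul_mem _ he, by
      rw [map_smul, smul_eq_mul, div_mul_cancel₀ _ hIe]⟩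
  · push Not at hI
    exact ⟨0, M.zero_mem, by rw [map_zero, hM I hI]⟩

/- Otherwise a functional `ℓ` separates the `ε`-neighbourhood of `B` from the affine subspace
`{f ∈ M | I f = h I}`. It agrees on `M` with a multiple of `I`, so that the affine subspace lies in
the hyperplane `ℓ = h ℓ`, whereas `h` lies on the side of `B`. -/
theorem exists_mem_exists_norm_sub_lt {B : Set E} (hB : Convex ℝ B) {h : Bidual E}
    (hM : ∀ ℓ : StrongDual ℝ E, (∀ f ∈ M, ℓ f = 0) → h ℓ = 0)
    (hhB : ∀ (ℓ : StrongDual ℝ E) (u : ℝ), (∀ g ∈ B, ℓ g < u) → h ℓ < u) (I : StrongDual ℝ E)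
    {ε : ℝ} (hε : 0 < ε) : ∃ f ∈ M, I f = h I ∧ ∃ g ∈ B, ‖f - g‖ < ε := by
  by_contra! hfar
  have hdisj : Disjoint (Metric.thickening ε B) {f | f ∈ M ∧ I f = h I} := by
    refine Set.disjoint_left.2 fun f hfB hf => ?_
    obtain ⟨g, hg, hfg⟩ := Metric.mem_thickening_iff.1 hfB
    exact (hfar f hf.1 hf.2 g hg).not_gt (by rwa [← dist_eq_norm])
  have hconvex : Convex ℝ {f | f ∈ M ∧ I f = h I} :=
    M.convex.inter (convex_hyperplane I.isLinear _)
  obtain ⟨ℓ, u, hℓB, hℓM⟩ := geometric_hahn_banach_open (hB.thickening ε)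
    Metric.isOpen_thickening hconvex hdisj
  obtain ⟨f₀, hf₀, hIf₀⟩ := exists_mem_apply_eq hM I
  have hnonneg (f : E) (hf : f ∈ M) (hIf : I f = 0) : 0 ≤ ℓ f := by
    refine neg_nonpos.1 (nonpos_of_forall_add_mul_le (a := -ℓ f₀) (u := -u) fun t _ => ?_)
    have hu := hℓM (f₀ + t • f) ⟨M.add_mem hf₀ (M.smul_mem t hf), by
      rw [map_add, map_smul, hIf, hIf₀, smul_zero, add_zero]⟩
    rw [map_add, map_smul, smul_eq_mul] at hu
    linarith
  have hker (f : E) (hf : f ∈ M) (hIf : I f = 0) : ℓ f = 0 := by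
    have hneg := hnonneg (-f) (M.neg_mem hf) (by rw [map_neg, hIf, neg_zero])
    rw [map_neg] at hneg
    exact le_antisymm (neg_nonneg.1 hneg) (hnonneg f hf hIf)
  obtain ⟨a, ha⟩ := exists_apply_eq_mul_of_ker_le hker
  have hhℓ : h ℓ = a * h I := by
    have hzero := hM (ℓ - a • I) fun f hf => sub_eq_zero.2 (ha f hf)
    rw [map_sub, map_smul] at hzero
    exact sub_eq_zero.1 hzero
  have hle := hℓM f₀ ⟨hf₀, hIf₀⟩
  rw [ha f₀ hf₀, hIf₀, ← hhℓ] at hle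
  exact hle.not_gt (hhB ℓ u fun g hg => hℓB g (Metric.self_subset_thickening hε B hg))

end Helly

section Duality

variable {Z : Type*} [MeasurableSpace Z] {π : Measure Z}

instance posSMulMono_L1 : PosSMulMono ℝ (Lp ℝ 1 π) where
  smul_le_smul_of_nonneg_left a ha f g hfg := by
    rw [← Lp.coeFn_le] at hfg ⊢
    filter_upwards [hfg, Lp.coeFn_smul a f, Lp.coeFn_smul a g] with z hz hf hg
    rw [hf, hg]
    exact mul_le_mul_of_nonneg_left hz ha

theorem isNonneg_of_forall_le_apply_le {ℓ : StrongDual ℝ (Lp ℝ 1 π)} {f₀ : Lp ℝ 1 π} {u : ℝ}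
    (h : ∀ f ≤ f₀, ℓ f ≤ u) : IsNonneg ℓ := fun f hf => by
  refine neg_nonpos.1 (nonpos_of_forall_add_mul_le (a := ℓ f₀) (u := u) fun t ht => ?_)
  have hle := h (f₀ - t • f) (sub_le_self _ (smul_nonneg ht hf))
  rw [map_sub, map_smul, smul_eq_mul] at hle
  linarith

theorem lintegral_ofReal_sub_le {c : Z → ℝ≥0∞} (hc : Measurable c) (hπ : ∫⁻ z, c z ∂π ≠ ∞)
    {f g : Lp ℝ 1 π} (hg : g ≤ costL1 c hc hπ) :
    ∫⁻ z, (ENNReal.ofReal (f z) - c z) ∂π ≤ ENNReal.ofReal ‖f - g‖ := by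
  rw [L1.ofReal_norm_eq_lintegral]
  refine lintegral_mono_ae ?_
  filter_upwards [Lp.coeFn_sub f g, (Lp.coeFn_le g _).2 hg, ae_lt_top hc hπ,
    Integrable.coeFn_toL1 (integrable_toReal_of_lintegral_ne_top hc.aemeasurable hπ)]
    with z hsub hgz hcz hcL1
  have hgc : g z ≤ (c z).toReal := hgz.trans_eq hcL1
  rw [hsub, Pi.sub_apply, tsub_le_iff_right, ← ENNReal.ofReal_toReal hcz.ne, ← ofReal_norm,
    ← ENNReal.ofReal_add (norm_nonneg _) ENNReal.toReal_nonneg]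
  exact ENNReal.ofReal_le_ofReal (by linarith [Real.le_norm_self (f z - g z)])

variable {X Y : Type*} [MeasurableSpace X] [MeasurableSpace Y] {μ : Measure X} {ν : Measure Y}
  {c : X × Y → ℝ≥0∞} {π : Measure (X × Y)}

variable (μ ν π) in
/-- The classes in `L¹(π)` of the functions `φ ⊕ ψ`, a dense subspace of `L¹_S(π)`. -/
def oplusL1 : Submodule ℝ (Lp ℝ 1 π) where
  carrier := {f | ∃ (φ : X → ℝ) (ψ : Y → ℝ), Integrable φ μ ∧ Integrable ψ ν ∧
    f =ᵐ[π] fun z => φ z.1 + ψ z.2}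
  add_mem' := by
    rintro f f' ⟨φ, ψ, hφ, hψ, hf⟩ ⟨φ', ψ', hφ', hψ', hf'⟩
    refine ⟨φ + φ', ψ + ψ', hφ.add hφ', hψ.add hψ', ?_⟩
    filter_upwards [hf, hf', Lp.coeFn_add f f'] with z hz hz' hadd
    rw [hadd, Pi.add_apply, hz, hz', add_add_add_comm, Pi.add_apply, Pi.add_apply]
  zero_mem' := ⟨0, 0, integrable_zero _ _ _, integrable_zero _ _ _, by
    filter_upwards [Lp.coeFn_zero ℝ 1 π] with z hz
    rw [hz, Pi.zero_apply, Pi.zero_apply, Pi.zero_apply, add_zero]⟩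
  smul_mem' a := by
    rintro f ⟨φ, ψ, hφ, hψ, hf⟩
    refine ⟨a • φ, a • ψ, hφ.smul a, hψ.smul a, ?_⟩
    filter_upwards [hf, Lp.coeFn_smul a f] with z hz hsmul
    rw [hsmul, Pi.smul_apply, hz, smul_add, Pi.smul_apply, Pi.smul_apply]

theorem L1S_eq_topologicalClosure_oplusL1 : L1S μ ν π = (oplusL1 μ ν π).topologicalClosure :=
  congrArg Submodule.topologicalClosure (oplusL1 μ ν π).span_eq

theorem apply_eq_zero_of_mem_bidualL1S {h : Bidual (Lp ℝ 1 π)} (hh : h ∈ bidualL1S μ ν π)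
    {ℓ : StrongDual ℝ (Lp ℝ 1 π)} (hℓ : ∀ f ∈ oplusL1 μ ν π, ℓ f = 0) : h ℓ = 0 := by
  refine (mem_range_bidualMap_subtypeL_iff _).1 hh ℓ fun f hf => ?_
  rw [L1S_eq_topologicalClosure_oplusL1] at hf
  exact (oplusL1 μ ν π).topologicalClosure_minimal (t := ℓ.ker) hℓ ℓ.isClosed_ker hf

theorem coe_le_coe_ennreal_of_ofReal_le {x : ℝ} {y : ℝ≥0∞} (h : ENNReal.ofReal x ≤ y) :
    (x : EReal) ≤ (y : EReal) :=
  calc (x : EReal) ≤ (ENNReal.ofReal x : EReal) := by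
        rw [EReal.coe_ennreal_ofReal]
        exact EReal.coe_le_coe_iff.2 (le_max_left x 0)
    _ ≤ y := EReal.coe_ennreal_le_coe_ennreal_iff.2 h

theorem integralDual_apply_eq_integral {π' : Measure (X × Y)} [IsFiniteMeasure π']
    [IsFiniteMeasure π] (hπ : π ∈ plans μ ν) (hπ' : π' ∈ plans μ ν) (hle : PlanLE π' π)
    {f : Lp ℝ 1 π} (hf : f ∈ oplusL1 μ ν π) : integralDual hle f = ∫ z, f z ∂π := by
  obtain ⟨φ, ψ, hφ, hψ, hf⟩ := hf
  rw [integralDual_apply, integral_congr_ae hf, integral_congr_ae (hle.1.ae_eq hf),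
    integral_oplus hπ hφ hψ, integral_oplus hπ' hφ hψ]

theorem pairing_le_dualEps (hc : Measurable c) (hπ : π ∈ finitePlans μ ν c)
    {h : Bidual (Lp ℝ 1 π)} (hh : h ∈ bidualFeasible μ ν c hc π hπ.2) {ε : ℝ} (hε : 0 < ε) :
    (pairing h : EReal) ≤ dualEps μ ν c π ε := by
  obtain ⟨f, ⟨φ, ψ, hφ, hψ, hf⟩, hpair, g, hg, hfg⟩ :=
    exists_mem_exists_norm_sub_lt (convex_Iic (𝕜 := ℝ) (costL1 c hc hπ.2))
      (fun ℓ => apply_eq_zero_of_mem_bidualL1S hh.1)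
      (fun ℓ u hu => (hh.2 ℓ (isNonneg_of_forall_le_apply_le fun f hf => (hu f hf).le)).trans_lt
        (hu _ Set.self_mem_Iic)) L1.integralCLM hε
  rw [integralCLM_apply, integral_congr_ae hf, integral_oplus hπ.1 hφ hψ] at hpair
  rw [pairing, ← hpair]
  refine le_iSup₂ (f := fun (p : (X → ℝ) × (Y → ℝ)) _ =>
    ((∫ x, p.1 x ∂μ + ∫ y, p.2 y ∂ν : ℝ) : EReal)) (φ, ψ) ⟨hφ, hψ, ?_⟩
  have hcongr : ∫⁻ z, (ENNReal.ofReal (φ z.1 + ψ z.2) - c z) ∂π =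
      ∫⁻ z, (ENNReal.ofReal (f z) - c z) ∂π :=
    lintegral_congr_ae (hf.mono fun z hz => by simp only [hz])
  exact hcongr.trans_le <|
    (lintegral_ofReal_sub_le hc hπ.2 hg).trans (ENNReal.ofReal_le_ofReal hfg.le)

variable [IsProbabilityMeasure μ]

theorem ofReal_pairing_le_lintegral (hc : Measurable c) (hπ : π ∈ finitePlans μ ν c)
    {h : Bidual (Lp ℝ 1 π)} (hh : h ∈ bidualFeasible μ ν c hc π hπ.2) {π' : Measure (X × Y)}
    (hπ' : π' ∈ plans μ ν) (hle : PlanLE π' π) :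
    ENNReal.ofReal (pairing h) ≤ ∫⁻ z, c z ∂π' := by
  have := isProbabilityMeasure_of_mem_plans hπ.1
  have := isProbabilityMeasure_of_mem_plans hπ'
  have heq : h (integralDual hle) - pairing h = 0 := by
    rw [pairing, ← map_sub]
    refine apply_eq_zero_of_mem_bidualL1S hh.1 fun f hf => sub_eq_zero.2 ?_
    exact (integralDual_apply_eq_integral hπ.1 hπ' hle hf).trans (integralCLM_apply f).symm
  refine ENNReal.ofReal_le_of_le_toReal ?_
  rw [← sub_eq_zero.1 heq, ← integralDual_costL1 hle hc hπ.2]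
  exact hh.2 _ (isNonneg_integralDual hle)

theorem dualBidual_le_primalAt (hc : Measurable c) (hπ : π ∈ finitePlans μ ν c) :
    dualBidual μ ν c hc π hπ.2 ≤ (primalAt μ ν c π : EReal) :=
  iSup₂_le fun _ hh => coe_le_coe_ennreal_of_ofReal_le
    (le_iInf₂ fun _ hπ' => ofReal_pairing_le_lintegral hc hπ hh hπ'.1 hπ'.2)

theorem dualEps_le (hc : Measurable c) (hπ : π ∈ plans μ ν) {π' : Measure (X × Y)}
    (hπ' : π' ∈ plans μ ν) (hle : PlanLE π' π) (ε : ℝ) :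
    dualEps μ ν c π ε ≤
      ((essSup (π'.rnDeriv π) π * ENNReal.ofReal ε + ∫⁻ z, c z ∂π' : ℝ≥0∞) : EReal) := by
  have := isProbabilityMeasure_of_mem_plans hπ
  have := isProbabilityMeasure_of_mem_plans hπ'
  refine iSup₂_le fun ⟨φ, ψ⟩ ⟨hφ, hψ, hε⟩ => coe_le_coe_ennreal_of_ofReal_le ?_
  rw [← integral_oplus hπ' hφ hψ]
  calc ENNReal.ofReal (∫ z, (φ z.1 + ψ z.2) ∂π')
      ≤ ∫⁻ z, ENNReal.ofReal (φ z.1 + ψ z.2) ∂π' := by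
        refine ENNReal.ofReal_le_of_le_toReal ?_
        rw [integral_eq_lintegral_pos_part_sub_lintegral_neg_part (integrable_oplus hπ' hφ hψ)]
        exact sub_le_self _ ENNReal.toReal_nonneg
    _ ≤ ∫⁻ z, ((ENNReal.ofReal (φ z.1 + ψ z.2) - c z) + c z) ∂π' :=
        lintegral_mono fun z => le_tsub_add
    _ = ∫⁻ z, (ENNReal.ofReal (φ z.1 + ψ z.2) - c z) ∂π' + ∫⁻ z, c z ∂π' :=
        lintegral_add_right _ hc
    _ ≤ essSup (π'.rnDeriv π) π * ENNReal.ofReal ε + ∫⁻ z, c z ∂π' := by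
        gcongr
        refine (lintegral_mono' hle.le_smul le_rfl).trans ?_
        rw [lintegral_smul_measure, smul_eq_mul]
        gcongr

theorem eventually_dualEps_lt (hc : Measurable c) (hπ : π ∈ plans μ ν) {b : EReal}
    (hb : (primalAt μ ν c π : EReal) < b) : ∀ᶠ ε in 𝓝[>] 0, dualEps μ ν c π ε < b := by
  obtain ⟨b', hb', hb'b⟩ := exists_between hb
  lift b' to ℝ≥0∞ using (EReal.coe_ennreal_nonneg _).trans hb'.le
  obtain ⟨π', ⟨hπ', hle⟩, hcost⟩ :
      ∃ π', ∃ _ : π' ∈ {π' | π' ∈ plans μ ν ∧ PlanLE π' π}, ∫⁻ z, c z ∂π' < b' := by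
    simpa only [primalAt, iInf_lt_iff] using EReal.coe_ennreal_lt_coe_ennreal_iff.1 hb'
  have hlim : Tendsto (fun ε : ℝ => essSup (π'.rnDeriv π) π * ENNReal.ofReal ε + ∫⁻ z, c z ∂π')
      (𝓝[>] 0) (𝓝 (∫⁻ z, c z ∂π')) := by
    have hε : Tendsto ENNReal.ofReal (𝓝[>] 0) (𝓝 0) :=
      (ENNReal.continuous_ofReal.tendsto' 0 0 ENNReal.ofReal_zero).mono_left nhdsWithin_le_nhds
    simpa only [mul_zero, zero_add] using
      (ENNReal.Tendsto.const_mul hε (Or.inr hle.2.ne)).add_const (∫⁻ z, c z ∂π')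
  filter_upwards [hlim.eventually_lt_const hcost] with ε hε
  exact (dualEps_le hc hπ hπ' hle ε).trans_lt
    ((EReal.coe_ennreal_lt_coe_ennreal_iff.2 hε).trans hb'b)

section FeasibleOptimum

variable (hc : Measurable c) (hπ : π ∈ finitePlans μ ν c) {h : Bidual (Lp ℝ 1 π)}
  (hh : h ∈ bidualFeasible μ ν c hc π hπ.2)
  (hpair : (pairing h : EReal) = (primalAt μ ν c π : EReal))
include hh hpair

theorem dualBidual_eq_primalAt :
    dualBidual μ ν c hc π hπ.2 = (primalAt μ ν c π : EReal) :=
  le_antisymm (dualBidual_le_primalAt hc hπ)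
    (hpair.ge.trans (le_iSup₂ (f := fun h _ => (pairing h : EReal)) h hh))

theorem tendsto_dualEps :
    Tendsto (dualEps μ ν c π) (𝓝[>] 0) (𝓝 (primalAt μ ν c π : EReal)) :=
  tendsto_order.2 ⟨fun _ hb => eventually_mem_nhdsWithin.mono fun _ hε =>
      hb.trans_le (hpair.ge.trans (pairing_le_dualEps hc hπ hh hε)),
    fun _ hb => eventually_dualEps_lt hc hπ.1 hb⟩

theorem dualAt_eq_primalAt : dualAt μ ν c π = (primalAt μ ν c π : EReal) :=
  (tendsto_dualEps hc hπ hh hpair).limUnder_eq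

end FeasibleOptimum

end Duality

section Attainment

theorem lintegral_eq_iSup_lintegral_min_natCast {Z : Type*} [MeasurableSpace Z] {m : Measure Z}
    {c : Z → ℝ≥0∞} (hc : Measurable c) :
    ∫⁻ z, c z ∂m = ⨆ N : ℕ, ∫⁻ z, min (N : ℝ≥0∞) (c z) ∂m := by
  rw [← lintegral_iSup (fun N => measurable_const.min hc)
    fun N M h z => min_le_min_right _ (Nat.cast_le.2 h)]
  refine lintegral_congr fun z => ?_
  change c z = ⨆ N : ℕ, (N : ℝ≥0∞) ⊓ c z
  rw [← iSup_inf_eq, ENNReal.iSup_natCast, top_inf_eq]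

section LowerSemicontinuous

variable {Z : Type*} [TopologicalSpace Z] [MeasurableSpace Z] [OpensMeasurableSpace Z]
  [HasOuterApproxClosed Z] {P : ProbabilityMeasure Z} {Q : ℕ → ProbabilityMeasure Z}

theorem lintegral_ofReal_le_liminf_of_lowerSemicontinuous {f : Z → ℝ}
    (hf : LowerSemicontinuous f) (hf₀ : ∀ z, 0 ≤ f z) (hQ : Tendsto Q atTop (𝓝 P)) :
    ∫⁻ z, ENNReal.ofReal (f z) ∂(P : Measure Z) ≤
      liminf (fun n => ∫⁻ z, ENNReal.ofReal (f z) ∂(Q n : Measure Z)) atTop := by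
  simp only [lintegral_eq_lintegral_meas_lt _ (Eventually.of_forall hf₀) hf.measurable.aemeasurable]
  calc ∫⁻ t in Set.Ioi 0, (P : Measure Z) {z | t < f z}
      ≤ ∫⁻ t in Set.Ioi 0, liminf (fun n => (Q n : Measure Z) {z | t < f z}) atTop :=
        lintegral_mono fun t =>
          ProbabilityMeasure.le_liminf_measure_open_of_tendsto hQ (hf.isOpen_preimage t)
    _ ≤ liminf (fun n => ∫⁻ t in Set.Ioi 0, (Q n : Measure Z) {z | t < f z}) atTop :=
        lintegral_liminf_le fun n => Antitone.measurable fun s t hst =>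
          measure_mono fun z hz => hst.trans_lt hz

theorem lintegral_le_liminf_of_lowerSemicontinuous {c : Z → ℝ≥0∞} (hc : LowerSemicontinuous c)
    (hQ : Tendsto Q atTop (𝓝 P)) :
    ∫⁻ z, c z ∂(P : Measure Z) ≤ liminf (fun n => ∫⁻ z, c z ∂(Q n : Measure Z)) atTop := by
  rw [lintegral_eq_iSup_lintegral_min_natCast hc.measurable]
  refine iSup_le fun N => ?_
  have hN : (N : ℝ≥0∞) ≠ ∞ := ENNReal.natCast_ne_top N
  have htrunc (z : Z) : ENNReal.ofReal (ENNReal.truncateToReal N (c z)) = min (N : ℝ≥0∞) (c z) :=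
    ENNReal.ofReal_toReal (ne_top_of_le_ne_top hN (min_le_left _ _))
  calc ∫⁻ z, min (N : ℝ≥0∞) (c z) ∂(P : Measure Z)
      ≤ liminf (fun n => ∫⁻ z, min (N : ℝ≥0∞) (c z) ∂(Q n : Measure Z)) atTop := by
        simp only [← htrunc]
        exact lintegral_ofReal_le_liminf_of_lowerSemicontinuous
          ((ENNReal.continuous_truncateToReal hN).comp_lowerSemicontinuous hc
            (ENNReal.monotone_truncateToReal hN))
          (fun _ => ENNReal.truncateToReal_nonneg) hQ
    _ ≤ liminf (fun n => ∫⁻ z, c z ∂(Q n : Measure Z)) atTop :=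
        liminf_le_liminf (Eventually.of_forall fun n => lintegral_mono fun z => min_le_right _ _)

end LowerSemicontinuous

variable {X Y : Type*}
  [TopologicalSpace X] [PolishSpace X] [MeasurableSpace X] [BorelSpace X]
  [TopologicalSpace Y] [PolishSpace Y] [MeasurableSpace Y] [BorelSpace Y]
  (μ : Measure X) (ν : Measure Y) [IsProbabilityMeasure μ] [IsProbabilityMeasure ν]

theorem isClosed_plans :
    IsClosed {P : ProbabilityMeasure (X × Y) | (P : Measure (X × Y)) ∈ plans μ ν} := by
  have hfst : IsClosed {P : ProbabilityMeasure (X × Y) |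
      P.map measurable_fst.aemeasurable = (⟨μ, inferInstance⟩ : ProbabilityMeasure X)} :=
    isClosed_eq (ProbabilityMeasure.continuous_map continuous_fst) continuous_const
  have hsnd : IsClosed {P : ProbabilityMeasure (X × Y) |
      P.map measurable_snd.aemeasurable = (⟨ν, inferInstance⟩ : ProbabilityMeasure Y)} :=
    isClosed_eq (ProbabilityMeasure.continuous_map continuous_snd) continuous_const
  convert hfst.inter hsnd using 1
  exact Set.ext fun P => ⟨fun h => ⟨Subtype.ext h.1, Subtype.ext h.2⟩,
    fun h => ⟨congrArg Subtype.val h.1, congrArg Subtype.val h.2⟩⟩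

theorem isCompact_plans :
    IsCompact {P : ProbabilityMeasure (X × Y) | (P : Measure (X × Y)) ∈ plans μ ν} := by
  rw [← (isClosed_plans μ ν).closure_eq]
  refine isCompact_closure_of_isTightMeasureSet (IsTightMeasureSet.prodMk
    ((isTightMeasureSet_singleton (μ := μ)).subset ?_)
    ((isTightMeasureSet_singleton (μ := ν)).subset ?_))
  · rintro _ ⟨_, ⟨P, hP, rfl⟩, rfl⟩
    exact hP.1
  · rintro _ ⟨_, ⟨P, hP, rfl⟩, rfl⟩
    exact hP.2

variable {μ ν}

theorem primalAttained_of_lowerSemicontinuous {c : X × Y → ℝ≥0∞} (hc : LowerSemicontinuous c) :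
    PrimalAttained μ ν c := by
  have hne : ((fun π : Measure (X × Y) => ∫⁻ z, c z ∂π) '' plans μ ν).Nonempty :=
    ⟨_, μ.prod ν, ⟨by simp, by simp⟩, rfl⟩
  obtain ⟨u, -, hu, huS⟩ := exists_seq_tendsto_sInf hne (OrderBot.bddBelow _)
  rw [sInf_image] at hu
  choose π hπ hπu using huS
  have hprob (n : ℕ) : IsProbabilityMeasure (π n) := isProbabilityMeasure_of_mem_plans (hπ n)
  obtain ⟨P, hP, k, hk, hlim⟩ := (isCompact_plans μ ν).isSeqCompact
    (x := fun n => ⟨π n, hprob n⟩) hπ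
  refine ⟨P, hP, le_antisymm ?_ (iInf₂_le (P : Measure (X × Y)) hP)⟩
  calc ∫⁻ z, c z ∂(P : Measure (X × Y))
      ≤ liminf (fun n => ∫⁻ z, c z ∂(π (k n))) atTop :=
        lintegral_le_liminf_of_lowerSemicontinuous hc hlim
    _ = primal μ ν c :=
        ((hu.comp hk.tendsto_atTop).congr fun n => (hπu (k n)).symm).liminf_eq

end Attainment

section Values

variable {X Y : Type*} [MeasurableSpace X] [MeasurableSpace Y] {μ : Measure X} {ν : Measure Y}
  [IsProbabilityMeasure μ] {c : X × Y → ℝ≥0∞} {π₀ : Measure (X × Y)}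

theorem primalAt_le_lintegral {π : Measure (X × Y)} (hπ : π ∈ plans μ ν) :
    primalAt μ ν c π ≤ ∫⁻ z, c z ∂π :=
  have := isProbabilityMeasure_of_mem_plans hπ
  iInf₂_le π ⟨hπ, PlanLE.refl⟩

theorem primalAt_antitone {π₁ π₂ : Measure (X × Y)} (h₁ : π₁ ∈ plans μ ν) (h₂ : π₂ ∈ plans μ ν)
    (h : PlanLE π₁ π₂) : primalAt μ ν c π₂ ≤ primalAt μ ν c π₁ := by
  have := isProbabilityMeasure_of_mem_plans h₁
  have := isProbabilityMeasure_of_mem_plans h₂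
  refine le_iInf₂ fun π' hπ' => ?_
  have := isProbabilityMeasure_of_mem_plans hπ'.1
  exact iInf₂_le π' ⟨hπ'.1, hπ'.2.trans h⟩

variable (hπ₀ : π₀ ∈ finitePlans μ ν c)
  (hmin : primalAt μ ν c π₀ = ⨅ π ∈ finitePlans μ ν c, primalAt μ ν c π)
include hπ₀ hmin

theorem primalAt_eq_of_isMin (π : PlansAbove μ ν c π₀) : primalAt μ ν c π.1 = primalAt μ ν c π₀ :=
  le_antisymm (primalAt_antitone hπ₀.1 π.2.1.1 π.2.2) (hmin.le.trans (iInf₂_le π.1 π.2.1))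

theorem primalAt_eq_primal_of_isMin (h : PrimalAttained μ ν c) :
    primalAt μ ν c π₀ = primal μ ν c := by
  refine le_antisymm ?_ (le_iInf₂ fun π hπ => iInf₂_le π hπ.1)
  obtain ⟨π, hπ, hval⟩ := h
  have hfin : π ∈ finitePlans μ ν c :=
    ⟨hπ, ne_top_of_le_ne_top hπ₀.2 (hval.trans_le (iInf₂_le π₀ hπ₀.1))⟩
  calc primalAt μ ν c π₀ ≤ primalAt μ ν c π := hmin.trans_le (iInf₂_le π hfin)
    _ ≤ ∫⁻ z, c z ∂π := primalAt_le_lintegral hπ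
    _ = primal μ ν c := hval

theorem exists_projectiveFamily_of_isMin (hc : Measurable c) :
    ∃ H : ∀ π : PlansAbove μ ν c π₀, Bidual (Lp ℝ 1 π.1), IsProjectiveFamily H ∧
      ∀ π : PlansAbove μ ν c π₀, H π ∈ bidualFeasible μ ν c hc π.1 π.2.1.2 ∧
        (pairing (H π) : EReal) = (primalAt μ ν c π.1 : EReal) := by
  have hfin : primalAt μ ν c π₀ ≠ ∞ := ne_top_of_le_ne_top hπ₀.2 (primalAt_le_lintegral hπ₀.1)
  obtain ⟨H, hproj, hH⟩ := exists_projectiveFamily (p := (primalAt μ ν c π₀).toReal) hc hπ₀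
    fun π => by rw [ENNReal.ofReal_toReal hfin, primalAt_eq_of_isMin hπ₀ hmin π]
  refine ⟨H, hproj, fun π => ⟨⟨(mem_range_bidualMap_subtypeL_iff _).2 (hH π).1, (hH π).2.1⟩, ?_⟩⟩
  rw [(hH π).2.2, primalAt_eq_of_isMin hπ₀ hmin π, EReal.coe_ennreal_toReal hfin]

end Values

end

end TransportBidual

open TransportBidual in
theorem theorem4p2_general
    {X Y : Type*} [MeasurableSpace X] [MeasurableSpace Y]
    (μ : Measure X) (ν : Measure Y) [IsProbabilityMeasure μ]
    (c : X × Y → ℝ≥0∞) (hc : Measurable c)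
    (π₀ : Measure (X × Y)) (hπ₀ : π₀ ∈ finitePlans μ ν c)
    (hmin : primalAt μ ν c π₀ = ⨅ π ∈ finitePlans μ ν c, primalAt μ ν c π) :
    (∃ H : ∀ π : PlansAbove μ ν c π₀, Bidual (Lp ℝ 1 π.1), IsProjectiveFamily H ∧
      ∀ π : PlansAbove μ ν c π₀,
        H π ∈ bidualL1S μ ν π.1 ∧
        BidualLE (H π) (toBidual (costL1 c hc π.2.1.2)) ∧
        (pairing (H π) : EReal) = dualBidual μ ν c hc π.1 π.2.1.2 ∧
        (∃! p : Lp ℝ 1 π.1 × Bidual (Lp ℝ 1 π.1), IsRegularSingular (H π) p.1 p.2) ∧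
        ∀ (r : Lp ℝ 1 π.1) (s : Bidual (Lp ℝ 1 π.1)),
          IsRegularSingular (H π) r s → r ≤ costL1 c hc π.2.1.2 ∧ BidualLE s 0) ∧
    (∀ π : PlansAbove μ ν c π₀,
      Tendsto (dualEps μ ν c π.1) (𝓝[>] (0 : ℝ)) (𝓝 (dualAt μ ν c π.1)) ∧
      dualBidual μ ν c hc π.1 π.2.1.2 = dualAt μ ν c π.1 ∧
      dualAt μ ν c π.1 = (primalAt μ ν c π.1 : EReal) ∧
      primalAt μ ν c π.1 = primalAt μ ν c π₀) ∧
    (PrimalAttained μ ν c →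
      ∀ π : PlansAbove μ ν c π₀,
        dualBidual μ ν c hc π.1 π.2.1.2 = (primal μ ν c : EReal) ∧
        dualAt μ ν c π.1 = (primal μ ν c : EReal) ∧
        primalAt μ ν c π.1 = primal μ ν c) := by
  obtain ⟨H, hproj, hH⟩ := exists_projectiveFamily_of_isMin hπ₀ hmin hc
  have hbidual (π : PlansAbove μ ν c π₀) := dualBidual_eq_primalAt hc π.2.1 (hH π).1 (hH π).2
  have hdual (π : PlansAbove μ ν c π₀) := dualAt_eq_primalAt hc π.2.1 (hH π).1 (hH π).2
  have hlim (π : PlansAbove μ ν c π₀) := tendsto_dualEps hc π.2.1 (hH π).1 (hH π).2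
  have heq (π : PlansAbove μ ν c π₀) := primalAt_eq_of_isMin hπ₀ hmin π
  refine ⟨⟨H, hproj, fun π => ?_⟩, fun π => ?_, fun hatt π => ?_⟩
  · obtain ⟨⟨hspan, hle⟩, hpair⟩ := hH π
    exact ⟨hspan, hle, hpair.trans (hbidual π).symm, existsUnique_isRegularSingular_of_le hle,
      fun r s hrs => hrs.le_and_bidualLE_zero hle⟩
  · exact ⟨(hdual π).symm ▸ hlim π, (hbidual π).trans (hdual π).symm, hdual π, heq π⟩
  · have hP := (heq π).trans (primalAt_eq_primal_of_isMin hπ₀ hmin hatt)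
    exact ⟨hP ▸ hbidual π, hP ▸ hdual π, hP⟩

open TransportBidual in
theorem theorem4p2
    {X Y : Type*}
    [TopologicalSpace X] [PolishSpace X] [MeasurableSpace X] [BorelSpace X]
    [TopologicalSpace Y] [PolishSpace Y] [MeasurableSpace Y] [BorelSpace Y]
    (μ : Measure X) (ν : Measure Y) [IsProbabilityMeasure μ] [IsProbabilityMeasure ν]
    (c : X × Y → ℝ≥0∞) (hc : Measurable c)
    (π₀ : Measure (X × Y)) (hπ₀ : π₀ ∈ TransportBidual.finitePlans μ ν c)
    (hmin : TransportBidual.primalAt μ ν c π₀ =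
      ⨅ π ∈ TransportBidual.finitePlans μ ν c, TransportBidual.primalAt μ ν c π) :
    (∃ H : ∀ π : TransportBidual.PlansAbove μ ν c π₀, TransportBidual.Bidual (Lp ℝ 1 π.1),
      TransportBidual.IsProjectiveFamily H ∧
      ∀ π : TransportBidual.PlansAbove μ ν c π₀,
        H π ∈ TransportBidual.bidualL1S μ ν π.1 ∧
        TransportBidual.BidualLE (H π)
          (TransportBidual.toBidual (TransportBidual.costL1 c hc π.2.1.2)) ∧
        (TransportBidual.pairing (H π) : EReal) =
          TransportBidual.dualBidual μ ν c hc π.1 π.2.1.2 ∧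
        (∃! p : Lp ℝ 1 π.1 × TransportBidual.Bidual (Lp ℝ 1 π.1),
          TransportBidual.IsRegularSingular (H π) p.1 p.2) ∧
        ∀ (r : Lp ℝ 1 π.1) (s : TransportBidual.Bidual (Lp ℝ 1 π.1)),
          TransportBidual.IsRegularSingular (H π) r s →
            r ≤ TransportBidual.costL1 c hc π.2.1.2 ∧ TransportBidual.BidualLE s 0) ∧
    (∀ π : TransportBidual.PlansAbove μ ν c π₀,
      Tendsto (TransportBidual.dualEps μ ν c π.1) (𝓝[>] (0 : ℝ))
        (𝓝 (TransportBidual.dualAt μ ν c π.1)) ∧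
      TransportBidual.dualBidual μ ν c hc π.1 π.2.1.2 = TransportBidual.dualAt μ ν c π.1 ∧
      TransportBidual.dualAt μ ν c π.1 = (TransportBidual.primalAt μ ν c π.1 : EReal) ∧
      TransportBidual.primalAt μ ν c π.1 = TransportBidual.primalAt μ ν c π₀) ∧
    (LowerSemicontinuous c → TransportBidual.PrimalAttained μ ν c) ∧
    (TransportBidual.PrimalAttained μ ν c →
      ∀ π : TransportBidual.PlansAbove μ ν c π₀,
        TransportBidual.dualBidual μ ν c hc π.1 π.2.1.2 = (TransportBidual.primal μ ν c : EReal) ∧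
        TransportBidual.dualAt μ ν c π.1 = (TransportBidual.primal μ ν c : EReal) ∧
        TransportBidual.primalAt μ ν c π.1 = TransportBidual.primal μ ν c) :=
  let ⟨hfamily, hvalues, hattained⟩ := theorem4p2_general μ ν c hc π₀ hπ₀ hmin
  ⟨hfamily, hvalues, primalAttained_of_lowerSemicontinuous, hattained⟩
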